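/- Conventions. A function $f$ on $(0,\infty)$ is completely monotone (CM) if it is smooth on $(0,\infty)$ and $(-1)^n f^{(n)}(x)\ge 0$ for all $n\ge 0$, $x>0$. For $\alpha,\beta>0$ let $$E_{\alpha,\beta}(z)=\sum_{n\ge 0}\frac{z^n}{\Gamma(\beta+\alpha n)},\qquad E_\alpha=E_{\alpha,1},\qquad F_{\alpha,\beta}(x)=E_{\alpha,\beta}(x^\alpha)\ (x\ge 0),$$ $$\mathcal L_\beta f(x)=f'(x)+\frac{\beta-1}{x}\,(f(x)-f(0)),\qquad \gamma(u,x)=\int_0^x t^{u-1}e^{-t}\,dt\quad(u,x>0),$$ and, for $\beta>1$, $x>0$, $$G_{\alpha,\beta}(x)=\frac{x^{1-\beta}e^x\,\gamma(\beta-1,x)}{\alpha\,\Gamma(\beta-1)}.$$ For $0<\alpha<2$ and $t>0$ let $$k_\alpha(t)=\frac{\sin(\pi\alpha)\,t^{\alpha-1}}{\pi\,(t^{2\alpha}-2\cos(\pi\alpha)\,t^\alpha+1)},$$ and for $\beta>1$ and a function $g$ on $(0,\infty)$ let $$A_\beta g(t)=\frac{1}{\Gamma(\beta-1)}\int_0^1(1-u)^{\beta-2}\,g(t/u)\,\frac{du}{u},\qquad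 t>0.$$ A nonnegative function $g$ on $(0,\infty)$ is called a Bernstein density of $f$ if $f(x)=\int_0^\infty e^{-xt}g(t)\,dt$ for all $x>0$, with convergent integrals. **Theorem B.** (a) For every $\alpha\in(0,1]$, the function $x\mapsto \dfrac{e^x}{\alpha}-E_\alpha(x^\alpha)$ is CM, with Bernstein density $k_\alpha$. (b) For every $\alpha\in(0,1]$ and $\beta>1$, the functions $G_{\alpha,\beta}-F_{\alpha,\beta}$ and $\mathcal L_\beta F_{\alpha,\beta}-G_{\alpha,\beta}$ are CM, with respective Bernstein densities $A_\beta k_\alpha$ and $A_\beta[t\mapsto t\,k_\alpha(t)]$. (c) For every $\alpha\in[1,2]$, the function $x\mapsto E_\alpha(x^\alpha)-\dfrac{e^x}{\alpha}$ is CM. For $\alpha\in[1,2)$ it has Bernstein density $-k_\alpha$; for $\alpha=2$ it is the Laplace transform of $\tfrac12\delta_1$, where $\delta_1$ is the unit mass at $1$. (d) For every $\alpha\in[1,2]$ and $\beta>1$, the functions $F_{\alpha,\beta}-G_{\alpha,\beta}$ and $G_{\alpha,\beta}-\mathcal L_\beta F_{\alpha,\beta}$ are CM. For $\alpha\in[1,2)$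 they have respective Bernstein densities $A_\beta[-k_\alpha]$ and $A_\beta[t\mapsto -t\,k_\alpha(t)]$; for $\alpha=2$ both have Bernstein density $t\mapsto \dfrac{(1-t)^{\beta-2}}{2\,\Gamma(\beta-1)}$ on $(0,1)$ and $0$ on $[1,\infty)$. -/

import Mathlib

open Set MeasureTheory
open scoped ContDiff

/-- A real function is completely monotone on `(0, ∞)` if it is smooth there and
`(-1) ^ n * f⁽ⁿ⁾(x) ≥ 0` for all `n ≥ 0` and `x > 0`. Values outside `(0, ∞)` are irrelevant. -/
def IsCompletelyMonotone (f : ℝ → ℝ) : Prop :=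
  ContDiffOn ℝ ∞ f (Ioi 0) ∧ ∀ n : ℕ, ∀ x : ℝ, 0 < x → 0 ≤ (-1 : ℝ) ^ n * iteratedDeriv n f x

/-- The generalized Mittag-Leffler function `E_{α,β}` at a real argument, for `α, β > 0`
(the series then converges everywhere). The classical function `E_α` is the case `β = 1`. -/
noncomputable def mittagLeffler (α β x : ℝ) : ℝ :=
  ∑' n : ℕ, x ^ n / Real.Gamma (β + α * n)

/-- `F_{α,β}(x) = E_{α,β}(x ^ α)`. -/
noncomputable def mlF (α β x : ℝ) : ℝ :=
  mittagLeffler α β (x ^ α)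

/-- The differential-difference operator
`L_β f (x) = f'(x) + (β - 1) / x * (f(x) - f(0))`. -/
noncomputable def diffDiffOp (β : ℝ) (f : ℝ → ℝ) (x : ℝ) : ℝ :=
  deriv f x + (β - 1) / x * (f x - f 0)

/-- The lower incomplete Gamma function `γ(u, x) = ∫_0^x t ^ (u - 1) e ^ (-t) dt`. -/
noncomputable def lowerGamma (u x : ℝ) : ℝ :=
  ∫ t in (0 : ℝ)..x, t ^ (u - 1) * Real.exp (-t)

/-- `x ^ (1 - β) e ^ x γ(β - 1, x) / (α Γ(β - 1))`. -/
noncomputable def expTerm (α β x : ℝ) : ℝ :=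
  x ^ (1 - β) * Real.exp x * lowerGamma (β - 1) x / (α * Real.Gamma (β - 1))

/-- `μ` is the Bernstein measure of `f`: it lives on `[0, ∞)` and `f` is its Laplace transform
on `(0, ∞)`. -/
def HasBernsteinMeasure (f : ℝ → ℝ) (μ : Measure ℝ) : Prop :=
  μ (Iio 0) = 0 ∧ ∀ x : ℝ, 0 < x →
    Integrable (fun t : ℝ => Real.exp (-(x * t))) μ ∧
      f x = ∫ t, Real.exp (-(x * t)) ∂μ

/-- `g` is a density on `(0, ∞)` of the Bernstein measure of `f`: it is nonnegative and `f` is its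
Laplace transform on `(0, ∞)`, with convergent integrals. -/
def HasBernsteinDensity (f g : ℝ → ℝ) : Prop :=
  (∀ t : ℝ, 0 < t → 0 ≤ g t) ∧ ∀ x : ℝ, 0 < x →
    IntegrableOn (fun t : ℝ => Real.exp (-(x * t)) * g t) (Ioi 0) ∧
      f x = ∫ t in Ioi (0 : ℝ), Real.exp (-(x * t)) * g t

/-- `k_α(t) = sin(πα) t ^ (α - 1) / (π (t ^ (2α) - 2 cos(πα) t ^ α + 1))`. -/
noncomputable def mlKernel (α t : ℝ) : ℝ :=
  Real.sin (Real.pi * α) * t ^ (α - 1) /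
    (Real.pi * (t ^ (2 * α) - 2 * Real.cos (Real.pi * α) * t ^ α + 1))

/-- The multiplicative (Abelian) transform
`A_β g (t) = 1 / Γ(β - 1) * ∫_0^1 (1 - u) ^ (β - 2) g(t / u) du / u`, that is, `1 / Γ(β)` times the
multiplicative convolution of `g` with the density of the Beta`(1, β - 1)` distribution. -/
noncomputable def betaTransform (β : ℝ) (g : ℝ → ℝ) (t : ℝ) : ℝ :=
  (1 / Real.Gamma (β - 1)) * ∫ u in Ioo (0 : ℝ) 1, (1 - u) ^ (β - 2) * g (t / u) / u

/-!
# Mittag-Leffler functions minus their exponential part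

The core is the identity `∫₀^∞ e ^ (-x t) k_α(t) dt = e ^ x / α - E_α(x ^ α)` for `0 < α < 2`
(`integral_exp_neg_mul_mlKernel`). Formally, `E_α(x ^ α)` is the Hankel contour integral of
`e ^ (x z) z ^ (α - 1) / (z ^ α - 1)`. Collapsing the contour onto the negative axis collects the
residue `e ^ x / α` at `z = 1`, the only pole off the cut because `α < 2`, and leaves the jump
`2πi k_α(t)` across the cut.

All contour integrals are carried out in the coordinate `w = log z`, where the cut plane becomes the
strip `|Im w| ≤ π`, the integrands extend analytically across its boundary, and Cauchy's theorem for
rectangles applies (`integral_jump_add_integral_edge_eq_zero`). The contour is split at a circle of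
radius `e ^ ρ > 1`. On that circle the integrand is expanded in powers `z ^ (-α n)`, and Hankel's
formula `arcIntegral_eq` evaluates each term: it gives the Mittag-Leffler coefficient and an
integral over the part of the cut outside the circle, and these integrals sum to the
tail of the Laplace transform of `k_α` (`integral_edge_eq`). The residue is removed by subtracting
`α⁻¹` times the same integrand for `α = 1`, whose jump vanishes and whose edge integral is given by
the same formula with `E₁(x) = e ^ x`.

For `β > 1`, the Beta integral shows that `F_{α,β}`, `G_{α,β}` and `L_β F_{α,β}` at `x` are the
averages of `E_α((x u) ^ α)`, `e ^ (x u) / α` and `E_α(y ^ α)'` at `y = x u`, with weight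
`(1 - u) ^ (β - 2) / Γ(β - 1)` on `(0, 1)`. By Fubini this average corresponds to `A_β` on
densities (`HasBernsteinDensity.betaTransform`), and `-d/dx` corresponds to multiplication by `t`.
Complete monotonicity follows from the densities by differentiating under the integral. For `α = 2`
everything is explicit, since `E₂(x ^ 2) = cosh x`.
-/

open Filter Topology

/-! ### Growth of the Gamma function and Mittag-Leffler series -/

theorem rpow_mul_exp_neg_le_Gamma {M s : ℝ} (hM : 0 < M) (hs : 1 ≤ s) :
    M ^ (s - 1) * Real.exp (-M) ≤ Real.Gamma s := by
  have hs0 : 0 < s := by linarith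
  have hint := Real.GammaIntegral_convergent hs0
  rw [Real.Gamma_eq_integral hs0]
  have hsub : Ioi M ⊆ Ioi (0 : ℝ) := Ioi_subset_Ioi hM.le
  calc M ^ (s - 1) * Real.exp (-M) = ∫ x in Ioi M, Real.exp (-x) * M ^ (s - 1) := by
        rw [integral_mul_const, integral_exp_neg_Ioi, mul_comm]
    _ ≤ ∫ x in Ioi M, Real.exp (-x) * x ^ (s - 1) := by
        refine setIntegral_mono_on ((integrableOn_exp_neg_Ioi M).mul_const _) (hint.mono_set hsub)
          measurableSet_Ioi fun x hx => ?_
        have : M ≤ x := le_of_lt hx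
        gcongr
    _ ≤ ∫ x in Ioi 0, Real.exp (-x) * x ^ (s - 1) := by
        refine setIntegral_mono_set hint ?_ (LE.le.eventuallyLE hsub)
        refine (ae_restrict_iff' measurableSet_Ioi).2 (ae_of_all _ fun x hx => ?_)
        exact mul_nonneg (Real.exp_pos _).le (Real.rpow_nonneg (le_of_lt hx) _)

/-- The Mittag-Leffler series has infinite radius of convergence: `Γ` outgrows every geometric
sequence along an arithmetic progression. -/
theorem summable_pow_div_Gamma {α b : ℝ} (hα : 0 < α) (r : ℝ) :
    Summable fun n : ℕ => r ^ n / Real.Gamma (b + α * n) := by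
  -- `M ^ α = 2 (|r| + 1)` makes the terms decay at least like `2 ^ (-n)`
  set q : ℝ := 2 * (|r| + 1) with hq
  have hq0 : 0 < q := by positivity
  set M : ℝ := q ^ (1 / α) with hM
  have hM0 : 0 < M := Real.rpow_pos_of_pos hq0 _
  have hMn : ∀ n : ℕ, M ^ (α * n) = q ^ n := fun n => by
    rw [hM, ← Real.rpow_mul hq0.le, ← mul_assoc, one_div_mul_cancel hα.ne', one_mul,
      Real.rpow_natCast]
  have hgeo : Summable fun n : ℕ => (Real.exp M * M ^ (1 - b)) * (1 / 2 : ℝ) ^ n :=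
    (summable_geometric_of_lt_one (by norm_num) (by norm_num)).mul_left _
  refine hgeo.of_norm_bounded_eventually_nat ?_
  have hev : ∀ᶠ n : ℕ in atTop, 1 - b ≤ α * n :=
    (tendsto_natCast_atTop_atTop.const_mul_atTop hα).eventually_ge_atTop _
  filter_upwards [hev] with n hn
  have h1 := rpow_mul_exp_neg_le_Gamma hM0 (s := b + α * n) (by linarith)
  have h2 : M ^ (b + α * n - 1) = q ^ n / M ^ (1 - b) := by
    rw [← hMn, ← Real.rpow_sub hM0]; ring_nf
  rw [h2] at h1
  have hlow : 0 < q ^ n / M ^ (1 - b) * Real.exp (-M) := by positivity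
  rw [norm_div, norm_pow, Real.norm_eq_abs, Real.norm_of_nonneg (hlow.le.trans h1)]
  calc |r| ^ n / Real.Gamma (b + α * n)
      ≤ (|r| + 1) ^ n / (q ^ n / M ^ (1 - b) * Real.exp (-M)) := by
        gcongr; linarith
    _ = Real.exp M * M ^ (1 - b) * (1 / 2) ^ n := by
        rw [hq, mul_pow, Real.exp_neg, div_pow, one_pow]
        field_simp

theorem summable_rpow_div_Gamma {α : ℝ} (hα : 0 < α) {y : ℝ} (hy : 0 < y) (b c : ℝ) :
    Summable fun n : ℕ => y ^ (α * n + b) / Real.Gamma (α * n + c) := by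
  refine ((summable_pow_div_Gamma (b := c) hα (y ^ α)).mul_left (y ^ b)).congr fun n => ?_
  rw [Real.rpow_add hy, Real.rpow_mul hy.le, Real.rpow_natCast, add_comm c]
  ring

theorem mlF_eq_tsum {α β x : ℝ} (hx : 0 ≤ x) :
    mlF α β x = ∑' n : ℕ, x ^ (α * n) / Real.Gamma (α * n + β) := by
  unfold mlF mittagLeffler
  refine tsum_congr fun n => ?_
  rw [Real.rpow_mul hx, Real.rpow_natCast, add_comm]

theorem mlF_zero {α β : ℝ} (hα : 0 < α) : mlF α β 0 = 1 / Real.Gamma β := by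
  rw [mlF, mittagLeffler, tsum_eq_single 0]
  · simp
  · intro n hn
    simp [Real.zero_rpow hα.ne', hn]

theorem summable_natCast_mul_rpow_div_Gamma {α : ℝ} (hα : 0 < α) {y : ℝ} (hy : 0 < y) (c : ℝ) :
    Summable fun n : ℕ => α * n * y ^ (α * n) / Real.Gamma (α * n + c) := by
  have h := (summable_pow_div_Gamma (b := c) hα (2 * y ^ α)).norm.mul_left α
  refine h.of_norm_bounded fun n => ?_
  -- the factor `n` is absorbed by doubling the argument of the series
  have h2 : (n : ℝ) ≤ 2 ^ n := by exact_mod_cast Nat.lt_two_pow_self.le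
  have h3 : 0 ≤ y ^ α := Real.rpow_nonneg hy.le _
  rw [Real.rpow_mul hy.le, Real.rpow_natCast, add_comm c, norm_div, norm_div, norm_mul, norm_mul,
    mul_pow, norm_mul, Real.norm_of_nonneg hα.le, Real.norm_of_nonneg (Nat.cast_nonneg n),
    Real.norm_of_nonneg (by positivity : (0 : ℝ) ≤ 2 ^ n), mul_div_assoc, mul_div_assoc, mul_assoc]
  gcongr

theorem hasDerivAt_mlF {α β x : ℝ} (hα : 0 < α) (hx : 0 < x) :
    HasDerivAt (mlF α β) (∑' n : ℕ, α * n * x ^ (α * n - 1) / Real.Gamma (α * n + β)) x := by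
  have hu := (summable_natCast_mul_rpow_div_Gamma hα (by positivity : 0 < 2 * x) β).norm.mul_right
    (2 / x)
  have hmem : x ∈ Ioo (x / 2) (2 * x) := ⟨by linarith, by linarith⟩
  have key := hasDerivAt_tsum_of_isPreconnected
    (g := fun (n : ℕ) (y : ℝ) => y ^ (α * n) / Real.Gamma (α * n + β))
    (g' := fun (n : ℕ) (y : ℝ) => α * n * y ^ (α * n - 1) / Real.Gamma (α * n + β))
    hu isOpen_Ioo (isPreconnected_Ioo (a := x / 2) (b := 2 * x))
    (fun n y hy => by
      have hy0 : 0 < y := by linarith [hy.1]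
      exact (Real.hasDerivAt_rpow_const (Or.inl hy0.ne')).div_const _)
    (fun n y hy => by
      have hy0 : 0 < y := by linarith [hy.1]
      rw [Real.rpow_sub_one hy0.ne', norm_div, norm_div, norm_mul, norm_mul _ ((2 * x) ^ _),
        norm_div, Real.norm_of_nonneg hy0.le, Real.norm_of_nonneg (Real.rpow_nonneg hy0.le _),
        Real.norm_of_nonneg (Real.rpow_nonneg (by positivity : 0 ≤ 2 * x) _)]
      have h1 : y ^ (α * n) ≤ (2 * x) ^ (α * n) :=
        Real.rpow_le_rpow hy0.le hy.2.le (by positivity)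
      have h2 : 1 / y ≤ 2 / x := by
        rw [div_le_div_iff₀ hy0 hx]; linarith [hy.1]
      calc ‖α * n‖ * (y ^ (α * n) / y) / ‖Real.Gamma (α * n + β)‖
          = ‖α * n‖ * y ^ (α * n) / ‖Real.Gamma (α * n + β)‖ * (1 / y) := by ring
        _ ≤ _ := by gcongr)
    hmem (by simpa using summable_rpow_div_Gamma hα hx 0 β) hmem
  refine key.congr_of_eventuallyEq ?_
  filter_upwards [lt_mem_nhds hx] with y hy
  exact mlF_eq_tsum hy.le

/-- `L_β` lowers each exponent and each Gamma argument of the series of `F_{α,β}` by one; the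
constant term is killed. -/
theorem diffDiffOp_mlF {α β x : ℝ} (hα : 0 < α) (hβ : 1 ≤ β) (hx : 0 < x) :
    diffDiffOp β (mlF α β) x =
      ∑' n : ℕ, x ^ (α * n + α - 1) / Real.Gamma (α * n + α + β - 1) := by
  have hs0 : Summable fun n : ℕ => x ^ (α * n) / Real.Gamma (α * n + β) := by
    simpa using summable_rpow_div_Gamma hα hx 0 β
  have hs1 : Summable fun n : ℕ => α * n * x ^ (α * n - 1) / Real.Gamma (α * n + β) := by
    refine ((summable_natCast_mul_rpow_div_Gamma hα hx β).mul_right (1 / x)).congr fun n => ?_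
    rw [Real.rpow_sub_one hx.ne']
    ring
  rw [diffDiffOp, (hasDerivAt_mlF hα hx).deriv, mlF_eq_tsum hx.le, mlF_zero hα,
    hs1.tsum_eq_zero_add, hs0.tsum_eq_zero_add]
  simp only [Nat.cast_zero, mul_zero, zero_mul, zero_div, zero_add, Real.rpow_zero,
    add_sub_cancel_left]
  rw [← tsum_mul_left, ← Summable.tsum_add ((summable_nat_add_iff 1).2 hs1)
    (((summable_nat_add_iff 1).2 hs0).mul_left _)]
  refine tsum_congr fun n => ?_
  have hpos : 0 < α * n + α + β - 1 := by
    have : 0 ≤ α * n := by positivity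
    linarith
  have hG : Real.Gamma (α * n + α + β) = (α * n + α + β - 1) * Real.Gamma (α * n + α + β - 1) := by
    rw [← Real.Gamma_add_one hpos.ne', sub_add_cancel]
  have hG0 := (Real.Gamma_pos_of_pos hpos).ne'
  push_cast
  rw [mul_add, mul_one, hG, Real.rpow_sub_one hx.ne']
  generalize Real.Gamma (α * n + α + β - 1) = G at *
  obtain ⟨d, hd⟩ : ∃ d, α * n + α + β - 1 = d := ⟨_, rfl⟩
  have hd0 : d ≠ 0 := hd ▸ hpos.ne'
  rw [hd, show α * n + α = d - β + 1 by linarith]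
  field_simp
  ring

/-! ### Beta integrals of Mittag-Leffler series -/

theorem integral_one_sub_rpow_mul_rpow {a b : ℝ} (ha : 0 < a) (hb : 0 < b) :
    ∫ u in Ioo (0 : ℝ) 1, (1 - u) ^ (b - 1) * u ^ (a - 1) =
      Real.Gamma a * Real.Gamma b / Real.Gamma (a + b) := by
  rw [show Real.Gamma a * Real.Gamma b / Real.Gamma (a + b) = ProbabilityTheory.beta a b from rfl,
    ProbabilityTheory.beta_eq_betaIntegralReal a b ha hb, Complex.betaIntegral,
    intervalIntegral.integral_of_le (by norm_num), ← integral_Ioc_eq_integral_Ioo,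
    ← RCLike.re_to_complex, ← integral_re]
  · refine setIntegral_congr_fun measurableSet_Ioc fun x ⟨hx1, hx₂⟩ ↦ ?_
    norm_cast
    rw [← Complex.ofReal_cpow, ← Complex.ofReal_cpow, RCLike.re_to_complex,
      Complex.re_mul_ofReal, Complex.ofReal_re, mul_comm]
    all_goals linarith
  · have := Complex.betaIntegral_convergent (u := a) (v := b) (by simpa) (by simpa)
    rwa [intervalIntegrable_iff_integrableOn_Ioc_of_le (by simp), IntegrableOn] at this

theorem integrableOn_one_sub_rpow_mul_rpow {a b : ℝ} (ha : 0 < a) (hb : 0 < b) :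
    IntegrableOn (fun u : ℝ => (1 - u) ^ (b - 1) * u ^ (a - 1)) (Ioo 0 1) := by
  -- a function whose Bochner integral is nonzero is integrable
  refine .of_integral_ne_zero ?_
  rw [integral_one_sub_rpow_mul_rpow ha hb]
  have := Real.Gamma_pos_of_pos ha
  have := Real.Gamma_pos_of_pos hb
  have := Real.Gamma_pos_of_pos (add_pos ha hb)
  positivity

/-- Averaging a Mittag-Leffler series against `(1 - u) ^ (β - 2)` shifts the arguments of the Gamma
function by `β - 1`, by the Beta integral. -/
theorem hasSum_integral_one_sub_rpow_mul_tsum {α b β x : ℝ} (hα : 0 < α) (hb : 0 < b) (hβ : 1 < β)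
    (hx : 0 < x) :
    HasSum (fun n : ℕ => Real.Gamma (β - 1) *
        (x ^ (α * n + b - 1) / Real.Gamma (α * n + b + β - 1)))
      (∫ u in Ioo (0 : ℝ) 1, (1 - u) ^ (β - 2) *
        ∑' n : ℕ, (x * u) ^ (α * n + b - 1) / Real.Gamma (α * n + b)) := by
  set F : ℕ → ℝ → ℝ := fun n u => (1 - u) ^ (β - 2) *
    ((x * u) ^ (α * n + b - 1) / Real.Gamma (α * n + b)) with hF
  have hpos : ∀ n : ℕ, 0 < α * n + b := fun n => by positivity
  have hFeq : ∀ n, EqOn (F n) (fun u => x ^ (α * n + b - 1) / Real.Gamma (α * n + b) *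
      ((1 - u) ^ (β - 1 - 1) * u ^ (α * n + b - 1))) (Ioo 0 1) := fun n u hu => by
    simp only [hF]
    rw [Real.mul_rpow hx.le hu.1.le]
    ring_nf
  have hFint : ∀ n, IntegrableOn (F n) (Ioo 0 1) := fun n => by
    refine IntegrableOn.congr_fun ?_ (hFeq n).symm measurableSet_Ioo
    exact (integrableOn_one_sub_rpow_mul_rpow (hpos n) (by linarith)).const_mul _
  have hFval : ∀ n, ∫ u in Ioo (0 : ℝ) 1, F n u = Real.Gamma (β - 1) *
        (x ^ (α * n + b - 1) / Real.Gamma (α * n + b + β - 1)) := fun n => by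
    rw [setIntegral_congr_fun measurableSet_Ioo (hFeq n), integral_const_mul,
      integral_one_sub_rpow_mul_rpow (hpos n) (by linarith), ← add_sub_assoc]
    have := (Real.Gamma_pos_of_pos (hpos n)).ne'
    field_simp
  have hFnorm : ∀ n, ∫ u in Ioo (0 : ℝ) 1, ‖F n u‖ = ∫ u in Ioo (0 : ℝ) 1, F n u := fun n => by
    refine setIntegral_congr_fun measurableSet_Ioo fun u hu => Real.norm_of_nonneg ?_
    have h1 : 0 ≤ 1 - u := by linarith [hu.2]
    have h2 : 0 ≤ x * u := mul_nonneg hx.le hu.1.le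
    exact mul_nonneg (Real.rpow_nonneg h1 _)
      (div_nonneg (Real.rpow_nonneg h2 _) (Real.Gamma_pos_of_pos (hpos n)).le)
  have hsum : Summable fun n => ∫ u in Ioo (0 : ℝ) 1, ‖F n u‖ := by
    simp_rw [hFnorm, hFval]
    refine Summable.mul_left _ ((summable_rpow_div_Gamma hα hx (b - 1) (b + β - 1)).congr ?_)
    intro n
    ring_nf
  have := hasSum_integral_of_summable_integral_norm hFint hsum
  simp_rw [hFval] at this
  simpa only [hF, tsum_mul_left] using this

theorem integral_one_sub_rpow_mul_tsum {α b β x : ℝ} (hα : 0 < α) (hb : 0 < b) (hβ : 1 < β)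
    (hx : 0 < x) :
    ∫ u in Ioo (0 : ℝ) 1, (1 - u) ^ (β - 2) *
        ∑' n : ℕ, (x * u) ^ (α * n + b - 1) / Real.Gamma (α * n + b) =
      Real.Gamma (β - 1) * ∑' n : ℕ, x ^ (α * n + b - 1) / Real.Gamma (α * n + b + β - 1) := by
  rw [← tsum_mul_left, (hasSum_integral_one_sub_rpow_mul_tsum hα hb hβ hx).tsum_eq]

theorem integrableOn_one_sub_rpow_mul_tsum {α b β x : ℝ} (hα : 0 < α) (hb : 0 < b) (hβ : 1 < β)
    (hx : 0 < x) :
    IntegrableOn (fun u : ℝ => (1 - u) ^ (β - 2) *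
        ∑' n : ℕ, (x * u) ^ (α * n + b - 1) / Real.Gamma (α * n + b)) (Ioo 0 1) := by
  have h := hasSum_integral_one_sub_rpow_mul_tsum hα hb hβ hx
  have hpos : ∀ n : ℕ, 0 < Real.Gamma (β - 1) *
        (x ^ (α * n + b - 1) / Real.Gamma (α * n + b + β - 1)) := fun n => by
    have h1 : 0 < α * n + b + β - 1 := by
      have : 0 ≤ α * n := by positivity
      linarith
    have := Real.Gamma_pos_of_pos h1
    have := Real.Gamma_pos_of_pos (sub_pos.2 hβ)
    have := Real.rpow_pos_of_pos hx (α * n + b - 1)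
    positivity
  -- a function whose Bochner integral is nonzero is integrable
  refine .of_integral_ne_zero (ne_of_gt ?_)
  rw [← h.tsum_eq]
  exact h.summable.tsum_pos (fun n => (hpos n).le) 0 (hpos 0)

theorem integrableOn_one_sub_rpow_mul_exp {β : ℝ} (hβ : 1 < β) (x : ℝ) :
    IntegrableOn (fun u : ℝ => (1 - u) ^ (β - 2) * Real.exp (x * u)) (Ioo 0 1) := by
  have h := integrableOn_one_sub_rpow_mul_rpow (a := 1) (b := β - 1) one_pos (by linarith)
  have h2 : IntegrableOn (fun u : ℝ => (1 - u) ^ (β - 2)) (Ioo 0 1) := by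
    refine h.congr_fun (fun u hu => ?_) measurableSet_Ioo
    simp only [sub_self, Real.rpow_zero, mul_one]
    ring_nf
  rw [← integrableOn_Icc_iff_integrableOn_Ioo] at h2 ⊢
  exact h2.mul_continuousOn (by fun_prop) isCompact_Icc

/-- `G_{α,β}` is the average of `e ^ (x u) / α` against `(1 - u) ^ (β - 2) / Γ(β - 1)`. -/
theorem expTerm_eq_integral {α β x : ℝ} (hx : 0 < x) :
    expTerm α β x = 1 / Real.Gamma (β - 1) *
      ∫ u in Ioo (0 : ℝ) 1, (1 - u) ^ (β - 2) * (Real.exp (x * u) / α) := by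
  have key : x ^ (1 - β) * Real.exp x * lowerGamma (β - 1) x =
      ∫ u in Ioo (0 : ℝ) 1, (1 - u) ^ (β - 2) * Real.exp (x * u) := by
    have h1 : lowerGamma (β - 1) x =
        x * ∫ u in (0 : ℝ)..1, (x * u) ^ (β - 1 - 1) * Real.exp (-(x * u)) := by
      rw [intervalIntegral.mul_integral_comp_mul_left
        (f := fun t => t ^ (β - 1 - 1) * Real.exp (-t)), mul_zero, mul_one, lowerGamma]
    have h2 : ∫ u in (0 : ℝ)..1, (x * u) ^ (β - 1 - 1) * Real.exp (-(x * u)) =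
        ∫ u in (0 : ℝ)..1, (x * (1 - u)) ^ (β - 1 - 1) * Real.exp (-(x * (1 - u))) := by
      have := intervalIntegral.integral_comp_sub_left (a := 0) (b := 1)
        (fun u => (x * u) ^ (β - 1 - 1) * Real.exp (-(x * u))) 1
      rw [this]
      norm_num
    rw [h1, h2, intervalIntegral.integral_of_le zero_le_one, integral_Ioc_eq_integral_Ioo,
      ← mul_assoc, ← integral_const_mul]
    refine setIntegral_congr_fun measurableSet_Ioo fun u hu => ?_
    have hu1 : 0 ≤ 1 - u := by linarith [hu.2]
    have e1 : x ^ (1 - β) * x * x ^ (β - 1 - 1) = 1 := by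
      nth_rewrite 2 [← Real.rpow_one x]
      rw [← Real.rpow_add hx, ← Real.rpow_add hx]
      norm_num
    have e2 : Real.exp x * Real.exp (-(x * (1 - u))) = Real.exp (x * u) := by
      rw [← Real.exp_add]; ring_nf
    have e3 : β - 2 = β - 1 - 1 := by ring
    rw [Real.mul_rpow hx.le hu1, e3, ← e2]
    linear_combination (1 - u) ^ (β - 1 - 1) * Real.exp x * Real.exp (-(x * (1 - u))) * e1
  rw [expTerm, key]
  simp_rw [← mul_div_assoc]
  rw [integral_div]
  ring

/-! ### Laplace transforms of positive measures -/

theorem HasBernsteinMeasure.mem_interior_integrableExpSet {f : ℝ → ℝ} {μ : Measure ℝ}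
    (h : HasBernsteinMeasure f μ) {x : ℝ} (hx : 0 < x) :
    x ∈ interior (ProbabilityTheory.integrableExpSet (fun t : ℝ => -t) μ) := by
  refine mem_interior_iff_mem_nhds.2 ?_
  filter_upwards [lt_mem_nhds hx] with y hy
  simpa [ProbabilityTheory.integrableExpSet] using (h.2 y hy).1

theorem HasBernsteinMeasure.eqOn_mgf {f : ℝ → ℝ} {μ : Measure ℝ} (h : HasBernsteinMeasure f μ) :
    EqOn f (ProbabilityTheory.mgf (fun t : ℝ => -t) μ) (Ioi 0) := fun x hx => by
  simp [ProbabilityTheory.mgf, (h.2 x hx).2]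

/-- The easy half of Bernstein's theorem. On `(0, ∞)` the Laplace transform is a moment generating
function, which may be differentiated under the integral sign. -/
theorem HasBernsteinMeasure.isCompletelyMonotone {f : ℝ → ℝ} {μ : Measure ℝ}
    (h : HasBernsteinMeasure f μ) : IsCompletelyMonotone f := by
  refine ⟨?_, fun n x hx => ?_⟩
  · refine ContDiffOn.congr ?_ h.eqOn_mgf
    intro x hx
    exact (ProbabilityTheory.analyticAt_mgf
      (h.mem_interior_integrableExpSet hx)).contDiffAt.contDiffWithinAt
  · have he : f =ᶠ[𝓝 x] ProbabilityTheory.mgf (fun t : ℝ => -t) μ :=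
      h.eqOn_mgf.eventuallyEq_of_mem (Ioi_mem_nhds hx)
    rw [(he.iteratedDeriv n).eq_of_nhds,
      ProbabilityTheory.iteratedDeriv_mgf (h.mem_interior_integrableExpSet hx),
      ← integral_const_mul]
    refine integral_nonneg_of_ae ?_
    have h0 : ∀ᵐ t ∂μ, 0 ≤ t := by
      rw [ae_iff]
      simpa [Set.Iio] using h.1
    filter_upwards [h0] with t ht
    rw [← mul_assoc, ← mul_pow]
    simp only [mul_neg, neg_mul, one_mul, neg_neg]
    positivity

theorem HasBernsteinMeasure.hasDerivAt {f : ℝ → ℝ} {μ : Measure ℝ} (h : HasBernsteinMeasure f μ)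
    {x : ℝ} (hx : 0 < x) :
    Integrable (fun t : ℝ => t * Real.exp (-(x * t))) μ ∧
      HasDerivAt f (-∫ t, t * Real.exp (-(x * t)) ∂μ) x := by
  have hx' := h.mem_interior_integrableExpSet hx
  constructor
  · simpa using (ProbabilityTheory.integrable_pow_mul_exp_of_mem_interior_integrableExpSet hx' 1).neg
  · have := (ProbabilityTheory.hasDerivAt_mgf hx').congr_of_eventuallyEq
      (h.eqOn_mgf.eventuallyEq_of_mem (Ioi_mem_nhds hx))
    simpa [integral_neg] using this

/-- A Bernstein density determines a Bernstein measure; the formulas translate integrals against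
the measure into integrals against the density. -/
theorem HasBernsteinDensity.exists_measure {f g : ℝ → ℝ} (h : HasBernsteinDensity f g) :
    ∃ μ : Measure ℝ, HasBernsteinMeasure f μ ∧ ∀ φ : ℝ → ℝ,
      (Integrable φ μ ↔ IntegrableOn (fun t => g t * φ t) (Ioi 0)) ∧
        ∫ t, φ t ∂μ = ∫ t in Ioi (0 : ℝ), g t * φ t := by
  have hg : AEMeasurable g (volume.restrict (Ioi 0)) := by
    have h1 := (h.2 1 one_pos).1.aemeasurable
    have h2 : AEMeasurable (fun t : ℝ => Real.exp t) (volume.restrict (Ioi 0)) := by fun_prop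
    refine (h2.mul h1).congr (ae_of_all _ fun t => ?_)
    simp only [Pi.mul_apply]
    rw [← mul_assoc, ← Real.exp_add]
    simp
  have hm : AEMeasurable (fun t => ENNReal.ofReal (g t)) (volume.restrict (Ioi 0)) :=
    hg.ennreal_ofReal
  have htop : ∀ᵐ t ∂(volume.restrict (Ioi (0 : ℝ))), ENNReal.ofReal (g t) < ⊤ :=
    ae_of_all _ fun t => ENNReal.ofReal_lt_top
  have hae : ∀ φ : ℝ → ℝ, (fun t => (ENNReal.ofReal (g t)).toReal • φ t)
      =ᵐ[volume.restrict (Ioi 0)] fun t => g t * φ t := fun φ => by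
    refine (ae_restrict_iff' measurableSet_Ioi).2 (ae_of_all _ fun t ht => ?_)
    simp only [ENNReal.toReal_ofReal (h.1 t ht), smul_eq_mul]
  set μ := (volume.restrict (Ioi (0 : ℝ))).withDensity fun t => ENNReal.ofReal (g t)
  have hφ : ∀ φ : ℝ → ℝ, (Integrable φ μ ↔ IntegrableOn (fun t => g t * φ t) (Ioi 0)) ∧
        ∫ t, φ t ∂μ = ∫ t in Ioi (0 : ℝ), g t * φ t := fun φ => by
    rw [integrable_withDensity_iff_integrable_smul₀' hm htop, integrable_congr (hae φ),
      integral_withDensity_eq_integral_toReal_smul₀ hm htop, integral_congr_ae (hae φ)]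
    exact ⟨Iff.rfl, rfl⟩
  refine ⟨μ, ⟨?_, fun x hx => ?_⟩, hφ⟩
  · refine withDensity_absolutelyContinuous _ _ ?_
    rw [Measure.restrict_apply measurableSet_Iio, Iio_inter_Ioi, Ioo_self, measure_empty]
  · rw [(hφ _).1, (hφ _).2]
    simpa only [mul_comm] using h.2 x hx

theorem HasBernsteinDensity.isCompletelyMonotone {f g : ℝ → ℝ} (h : HasBernsteinDensity f g) :
    IsCompletelyMonotone f :=
  let ⟨_, hμ, _⟩ := h.exists_measure
  hμ.isCompletelyMonotone

theorem HasBernsteinDensity.congr {f f' g g' : ℝ → ℝ} (h : HasBernsteinDensity f g)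
    (hf : EqOn f' f (Ioi 0)) (hg : EqOn g' g (Ioi 0)) : HasBernsteinDensity f' g' := by
  refine ⟨fun t ht => (hg ht).symm ▸ h.1 t ht, fun x hx => ?_⟩
  have he : EqOn (fun t => Real.exp (-(x * t)) * g t) (fun t => Real.exp (-(x * t)) * g' t)
      (Ioi 0) := fun t ht => by simp only [hg ht]
  rw [hf hx, (h.2 x hx).2]
  exact ⟨(h.2 x hx).1.congr_fun he measurableSet_Ioi, setIntegral_congr_fun measurableSet_Ioi he⟩

theorem HasBernsteinDensity.neg_deriv {f g : ℝ → ℝ} (h : HasBernsteinDensity f g) :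
    HasBernsteinDensity (fun x => -deriv f x) (fun t => t * g t) := by
  obtain ⟨μ, hμ, hφ⟩ := h.exists_measure
  refine ⟨fun t ht => mul_nonneg ht.le (h.1 t ht), fun x hx => ?_⟩
  obtain ⟨h1, h2⟩ := hμ.hasDerivAt hx
  have he : (fun t => Real.exp (-(x * t)) * (t * g t)) =
      fun t => g t * (t * Real.exp (-(x * t))) := by
    ext t; ring
  beta_reduce
  rw [h2.deriv, neg_neg, he]
  exact ⟨(hφ _).1.1 h1, (hφ _).2⟩

/-! ### The Abelian transform of a density -/

/-- By Fubini, the transform `A_β` on the density side corresponds to averaging the function over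
`(0, x)` with weight `(1 - u) ^ (β - 2) / Γ(β - 1)`. -/
theorem HasBernsteinDensity.betaTransform {β : ℝ} {f g : ℝ → ℝ} (h : HasBernsteinDensity f g)
    (hβ : 1 < β) (hg : Measurable g)
    (hint : ∀ x, 0 < x → IntegrableOn (fun u => (1 - u) ^ (β - 2) * f (x * u)) (Ioo 0 1)) :
    HasBernsteinDensity
      (fun x => 1 / Real.Gamma (β - 1) * ∫ u in Ioo (0 : ℝ) 1, (1 - u) ^ (β - 2) * f (x * u))
      (betaTransform β g) := by
  have hΓ := Real.Gamma_pos_of_pos (sub_pos.2 hβ)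
  refine ⟨fun t ht => ?_, fun x hx => ?_⟩
  · refine mul_nonneg (by positivity) (setIntegral_nonneg measurableSet_Ioo fun u hu => ?_)
    have h1 : 0 ≤ 1 - u := by linarith [hu.2]
    exact div_nonneg (mul_nonneg (Real.rpow_nonneg h1 _) (h.1 _ (div_pos ht hu.1))) hu.1.le
  set Φ : ℝ → ℝ → ℝ := fun t u =>
    Real.exp (-(x * t)) * ((1 - u) ^ (β - 2) * g (t / u) / u) with hΦ
  have hscale : ∀ u ∈ Ioo (0 : ℝ) 1, (fun t => Φ t u) = fun t =>
      (1 - u) ^ (β - 2) * u⁻¹ * (fun s => Real.exp (-(x * u * s)) * g s) (u⁻¹ * t) := fun u hu => by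
    ext t
    have hu0 := hu.1.ne'
    simp only [hΦ]
    rw [show x * u * (u⁻¹ * t) = x * t by field_simp, show t / u = u⁻¹ * t by ring]
    ring
  have hsec : ∀ u ∈ Ioo (0 : ℝ) 1, IntegrableOn (fun t => Φ t u) (Ioi 0) := fun u hu => by
    rw [hscale u hu]
    refine Integrable.const_mul ?_ _
    refine (integrableOn_Ioi_comp_mul_left_iff
      (fun s => Real.exp (-(x * u * s)) * g s) 0 (inv_pos.2 hu.1)).2 ?_
    rw [mul_zero]
    exact (h.2 _ (mul_pos hx hu.1)).1
  have hval : ∀ u ∈ Ioo (0 : ℝ) 1, ∫ t in Ioi (0 : ℝ), Φ t u = (1 - u) ^ (β - 2) * f (x * u) :=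
    fun u hu => by
      rw [hscale u hu, integral_const_mul, integral_comp_mul_left_Ioi
        (fun s => Real.exp (-(x * u * s)) * g s) 0 (inv_pos.2 hu.1),
        mul_zero, ← (h.2 _ (mul_pos hx hu.1)).2, inv_inv, smul_eq_mul]
      have := hu.1.ne'
      field_simp
  have hnn : ∀ u ∈ Ioo (0 : ℝ) 1, ∀ t ∈ Ioi (0 : ℝ), 0 ≤ Φ t u := fun u hu t ht => by
    have h1 : 0 ≤ 1 - u := by linarith [hu.2]
    exact mul_nonneg (Real.exp_pos _).le
      (div_nonneg (mul_nonneg (Real.rpow_nonneg h1 _) (h.1 _ (div_pos ht hu.1))) hu.1.le)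
  have hmeas : Measurable (Function.uncurry Φ) := by
    simp only [hΦ, Function.uncurry_def]
    fun_prop
  have hprod : Integrable (Function.uncurry Φ)
      ((volume.restrict (Ioi 0)).prod (volume.restrict (Ioo 0 1))) := by
    rw [integrable_prod_iff' hmeas.aestronglyMeasurable]
    refine ⟨(ae_restrict_iff' measurableSet_Ioo).2 (ae_of_all _ hsec), ?_⟩
    refine IntegrableOn.congr_fun (hint x hx) (fun u hu => ?_) measurableSet_Ioo
    rw [← hval u hu]
    exact setIntegral_congr_fun measurableSet_Ioi fun t ht =>
      (Real.norm_of_nonneg (hnn u hu t ht)).symm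
  have hinner : ∀ t, Real.exp (-(x * t)) * _root_.betaTransform β g t =
      1 / Real.Gamma (β - 1) * ∫ u in Ioo (0 : ℝ) 1, Φ t u := fun t => by
    simp only [hΦ, _root_.betaTransform]
    rw [integral_const_mul]
    ring
  simp_rw [hinner]
  refine ⟨hprod.integral_prod_left.const_mul _, ?_⟩
  rw [integral_const_mul, integral_integral_swap hprod]
  congr 1
  exact setIntegral_congr_fun measurableSet_Ioo fun u hu => (hval u hu).symm

/-! ### Cauchy's theorem in the logarithmic coordinate -/

open Complex in
/-- Cauchy's theorem on the half-strip `Re w ≤ ρ`, `|Im w| ≤ π`, which is the plane cut along the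
negative axis in the logarithmic coordinate `z = e ^ w`. The jump of `F` across the cut is
expressed as `t φ(t)` at `t = e ^ τ`. -/
theorem integral_jump_add_integral_edge_eq_zero {F : ℂ → ℂ} {φ : ℝ → ℂ} {B : ℝ → ℝ} {ρ : ℝ}
    (hF : DifferentiableOn ℂ F {w | |w.im| ≤ Real.pi}) (hφc : ContinuousOn φ (Ioi 0))
    (hφi : IntervalIntegrable φ volume 0 (Real.exp ρ))
    (hjump : ∀ τ : ℝ, F (τ + ((-Real.pi : ℝ) : ℂ) * I) - F (τ + (Real.pi : ℂ) * I) =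
      Real.exp τ * φ (Real.exp τ))
    (hB : Tendsto B atBot (𝓝 0)) (hFB : ∀ w : ℂ, w.re < 0 → |w.im| ≤ Real.pi → ‖F w‖ ≤ B w.re) :
    (∫ t in (0 : ℝ)..Real.exp ρ, φ t) + I * ∫ y in (-Real.pi)..Real.pi, F (ρ + y * I) = 0 := by
  have hπ := Real.pi_pos
  have hcont : ∀ s : ℝ, |s| ≤ Real.pi → Continuous fun τ : ℝ => F (τ + (s : ℂ) * I) := by
    intro s hs
    refine hF.continuousOn.comp_continuous (by fun_prop) fun τ => ?_
    simpa using hs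
  -- the identity on a finite rectangle
  have hrect : ∀ τ₀ : ℝ, (∫ t in Real.exp τ₀..Real.exp ρ, φ t) +
      I * (∫ y in (-Real.pi)..Real.pi, F (ρ + y * I)) -
      I * (∫ y in (-Real.pi)..Real.pi, F (τ₀ + y * I)) = 0 := by
    intro τ₀
    have h := integral_boundary_rect_eq_zero_of_differentiableOn F
      (⟨τ₀, -Real.pi⟩ : ℂ) (⟨ρ, Real.pi⟩ : ℂ) (hF.mono fun w hw => ?_)
    · simp only [smul_eq_mul] at h
      rw [← h]
      congr 2
      rw [← intervalIntegral.integral_sub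
        ((hcont _ (by simp [abs_of_pos hπ])).intervalIntegrable _ _)
        ((hcont _ (by simp [abs_of_pos hπ])).intervalIntegrable _ _)]
      simp_rw [hjump]
      have hs := intervalIntegral.integral_deriv_smul_comp' (a := τ₀) (b := ρ) (f := Real.exp)
        (f' := Real.exp) (g := φ) (fun x _ => Real.hasDerivAt_exp x)
        Real.continuous_exp.continuousOn (hφc.mono ?_)
      · rw [← hs]
        simp
      · rintro _ ⟨x, -, rfl⟩
        exact Real.exp_pos x
    · have := hw.2
      simp only [uIcc_of_le (by linarith : -Real.pi ≤ Real.pi), mem_preimage, mem_Icc] at this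
      exact abs_le.2 this
  have hleft : Tendsto (fun τ₀ : ℝ => ∫ y in (-Real.pi)..Real.pi, F (τ₀ + y * I)) atBot (𝓝 0) := by
    have hB' : Tendsto (fun τ => B τ * |Real.pi - -Real.pi|) atBot (𝓝 0) := by
      simpa using hB.mul_const |Real.pi - -Real.pi|
    refine squeeze_zero_norm' ?_ hB'
    filter_upwards [eventually_lt_atBot 0] with τ hτ
    refine intervalIntegral.norm_integral_le_of_norm_le_const fun y hy => ?_
    rw [uIoc_of_le (by linarith)] at hy
    have := hFB (τ + y * I) (by simpa using hτ) (by simpa using abs_le.2 ⟨hy.1.le, hy.2⟩)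
    simpa using this
  have hbot : Tendsto (fun τ₀ : ℝ => ∫ t in Real.exp τ₀..Real.exp ρ, φ t) atBot
      (𝓝 (∫ t in (0 : ℝ)..Real.exp ρ, φ t)) := by
    have hR := Real.exp_pos ρ
    have hc := intervalIntegral.continuousOn_primitive_interval_left
      ((intervalIntegrable_iff' (by simp)).1 hφi) 0 left_mem_uIcc
    refine hc.tendsto.comp (tendsto_nhdsWithin_iff.2 ⟨Real.tendsto_exp_atBot, ?_⟩)
    filter_upwards [eventually_le_atBot ρ] with τ hτ
    rw [uIcc_of_le hR.le]
    exact ⟨(Real.exp_pos _).le, Real.exp_le_exp.2 hτ⟩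
  have hlim := (hbot.add_const (I * ∫ y in (-Real.pi)..Real.pi, F (ρ + y * I))).sub
    (hleft.const_mul I)
  simp_rw [hrect] at hlim
  simpa using (tendsto_nhds_unique tendsto_const_nhds hlim).symm

/-! ### Hankel's formula for the reciprocal Gamma function -/

/-- The integral of `e ^ (x z) z ^ (-a)` with respect to `y = arg z` over the circle of radius `e ^ ρ`
cut at the negative axis, where `z = e ^ (ρ + i y)`, `|y| ≤ π`, and `z ^ (-a)` is the principal
branch. -/
noncomputable def arcIntegral (x ρ a : ℝ) : ℂ :=
  ∫ y in (-Real.pi)..Real.pi, Complex.exp (x * Complex.exp (ρ + y * Complex.I)) *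
    Complex.exp (-(a * (ρ + y * Complex.I)))

theorem Complex.exp_ofReal_add_pi_mul_I (τ : ℝ) :
    Complex.exp (τ + (Real.pi : ℂ) * Complex.I) = -(Real.exp τ : ℂ) := by
  rw [Complex.exp_add, Complex.exp_pi_mul_I]
  push_cast
  ring

theorem Complex.exp_ofReal_add_neg_pi_mul_I (τ : ℝ) :
    Complex.exp (τ + ((-Real.pi : ℝ) : ℂ) * Complex.I) = -(Real.exp τ : ℂ) := by
  rw [Complex.exp_add, Complex.ofReal_neg, neg_mul, Complex.exp_neg, Complex.exp_pi_mul_I]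
  push_cast
  ring

theorem norm_exp_mul_exp_le {x : ℝ} (hx : 0 < x) {w : ℂ} (hw : w.re < 0) :
    ‖Complex.exp (x * Complex.exp w)‖ ≤ Real.exp x := by
  rw [Complex.norm_exp]
  refine Real.exp_le_exp.2 ?_
  rw [Complex.re_ofReal_mul]
  have h1 : (Complex.exp w).re ≤ 1 := by
    refine (Complex.re_le_norm _).trans ?_
    rw [Complex.norm_exp]
    exact Real.exp_le_one_iff.2 hw.le
  nlinarith

theorem integrableOn_exp_neg_mul_rpow_Ioi {x R : ℝ} (hx : 0 < x) (hR : 0 < R) (p : ℝ) :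
    IntegrableOn (fun t : ℝ => Real.exp (-(x * t)) * t ^ p) (Ioi R) := by
  by_cases hp : -1 < p
  · have h := integrableOn_rpow_mul_exp_neg_mul_rpow hp one_pos hx
    refine (h.mono_set (Ioi_subset_Ioi hR.le)).congr_fun (fun t ht => ?_) measurableSet_Ioi
    simp only [Real.rpow_one, neg_mul]
    ring
  · have hexp : IntegrableOn (fun t : ℝ => Real.exp (-(x * t))) (Ioi R) := by
      simpa using integrableOn_exp_mul_Ioi (neg_lt_zero.2 hx) R
    refine (hexp.mul_const (R ^ p)).mono' (by fun_prop) ?_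
    refine (ae_restrict_iff' measurableSet_Ioi).2 (ae_of_all _ fun t ht => ?_)
    have ht0 : 0 < t := hR.trans ht
    rw [Real.norm_of_nonneg (by positivity)]
    exact mul_le_mul_of_nonneg_left
      (Real.rpow_le_rpow_of_nonpos hR (le_of_lt ht) (by linarith)) (Real.exp_pos _).le

theorem integral_exp_neg_mul_rpow_Ioi_zero {x a : ℝ} (hx : 0 < x) (ha : a < 0) :
    ∫ t in Ioi (0 : ℝ), Real.exp (-(x * t)) * t ^ (-a - 1) = Real.Gamma (-a) * x ^ a := by
  have h := Real.integral_rpow_mul_exp_neg_mul_Ioi (neg_pos.2 ha) hx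
  rw [one_div, Real.inv_rpow hx.le, Real.rpow_neg hx.le, inv_inv] at h
  rw [mul_comm, ← h]
  exact setIntegral_congr_fun measurableSet_Ioi fun t _ => mul_comm _ _

/-- Hankel's formula for exponents at which the contour may be collapsed onto the cut. -/
theorem arcIntegral_of_neg {x ρ a : ℝ} (hx : 0 < x) (ha : -1 < a) (ha0 : a < 0) :
    arcIntegral x ρ a = ((2 * Real.sin (Real.pi * a) *
      (∫ t in Ioi (Real.exp ρ), Real.exp (-(x * t)) * t ^ (-a - 1)) +
        2 * Real.pi * (x ^ a / Real.Gamma (a + 1)) : ℝ) : ℂ) := by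
  have hR := Real.exp_pos ρ
  set φ₀ : ℝ → ℝ := fun t => Real.exp (-(x * t)) * t ^ (-a - 1) with hφ₀
  have hφ₀i : IntegrableOn φ₀ (Ioi 0) := by
    have h := integrableOn_rpow_mul_exp_neg_mul_rpow (p := 1) (s := -a - 1) (by linarith) one_pos hx
    refine h.congr_fun (fun t ht => ?_) measurableSet_Ioi
    simp only [hφ₀, Real.rpow_one, neg_mul]
    ring
  have hφ₀ii : IntervalIntegrable φ₀ volume 0 (Real.exp ρ) :=
    (intervalIntegrable_iff_integrableOn_Ioc_of_le hR.le).2 (hφ₀i.mono_set Ioc_subset_Ioi_self)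
  have hsplit : (∫ t in (0 : ℝ)..Real.exp ρ, φ₀ t) =
      Real.Gamma (-a) * x ^ a - ∫ t in Ioi (Real.exp ρ), φ₀ t := by
    rw [← integral_exp_neg_mul_rpow_Ioi_zero hx ha0, eq_sub_iff_add_eq,
      intervalIntegral.integral_interval_add_Ioi hφ₀i (hφ₀i.mono_set (Ioi_subset_Ioi hR.le))]
  have key := integral_jump_add_integral_edge_eq_zero (ρ := ρ)
    (F := fun w => Complex.exp (x * Complex.exp w) * Complex.exp (-(a * w)))
    (φ := fun t => 2 * Complex.I * Real.sin (Real.pi * a) * (φ₀ t : ℂ))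
    (B := fun τ => Real.exp x * Real.exp (-a * τ)) (by fun_prop) ?_ ?_ ?_ ?_ ?_
  · rw [intervalIntegral.integral_const_mul, intervalIntegral.integral_ofReal, hsplit] at key
    have harc : Complex.I * arcIntegral x ρ a = Complex.I * (-(2 * Real.sin (Real.pi * a) *
        ((Real.Gamma (-a) * x ^ a - ∫ t in Ioi (Real.exp ρ), φ₀ t : ℝ) : ℂ))) := by
      rw [arcIntegral]
      linear_combination key
    rw [mul_left_cancel₀ Complex.I_ne_zero harc]
    have hΓ : Real.sin (Real.pi * a) * Real.Gamma (-a) = -(Real.pi / Real.Gamma (a + 1)) := by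
      have h := Real.Gamma_mul_Gamma_one_sub (-a)
      rw [mul_neg, Real.sin_neg, sub_neg_eq_add, add_comm 1 a] at h
      have hs : Real.sin (Real.pi * a) ≠ 0 := by
        have h2 := Real.sin_pos_of_pos_of_lt_pi (x := Real.pi * -a)
          (mul_pos Real.pi_pos (by linarith)) (by nlinarith [Real.pi_pos])
        rw [mul_neg, Real.sin_neg] at h2
        linarith
      have hG := (Real.Gamma_pos_of_pos (by linarith : 0 < a + 1)).ne'
      rw [eq_div_iff (neg_ne_zero.2 hs)] at h
      field_simp
      linear_combination -h
    norm_cast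
    linear_combination (-2 * x ^ a) * hΓ
  · refine ContinuousOn.mul (by fun_prop) (Complex.continuous_ofReal.comp_continuousOn ?_)
    refine ContinuousOn.mul (by fun_prop) fun t ht => ?_
    exact (Real.continuousAt_rpow_const _ _ (Or.inl (ne_of_gt ht))).continuousWithinAt
  · exact IntervalIntegrable.const_mul ⟨hφ₀ii.1.ofReal, hφ₀ii.2.ofReal⟩ _
  · intro τ
    simp only [Complex.exp_ofReal_add_pi_mul_I, Complex.exp_ofReal_add_neg_pi_mul_I, hφ₀]
    have h1 : Real.exp τ * Real.exp τ ^ (-a - 1) = Real.exp (-(a * τ)) := by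
      rw [← Real.exp_mul, ← Real.exp_add]; ring_nf
    have h2 : Complex.exp (-(a * (τ + ((-Real.pi : ℝ) : ℂ) * Complex.I))) -
        Complex.exp (-(a * (τ + (Real.pi : ℂ) * Complex.I))) =
        Real.exp (-(a * τ)) * (2 * Complex.I * Real.sin (Real.pi * a)) := by
      rw [Complex.ofReal_sin, Complex.sin,
        show -((a : ℂ) * (τ + ((-Real.pi : ℝ) : ℂ) * Complex.I)) =
          -(a * τ) + (Real.pi * a) * Complex.I by push_cast; ring,
        show -((a : ℂ) * (τ + (Real.pi : ℂ) * Complex.I)) =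
          -(a * τ) + -(Real.pi * a) * Complex.I by ring,
        Complex.exp_add, Complex.exp_add]
      push_cast
      ring_nf
      rw [Complex.I_sq]
      ring
    have h3 : Complex.exp (x * -(Real.exp τ : ℂ)) = (Real.exp (-(x * Real.exp τ)) : ℝ) := by
      push_cast
      ring_nf
    rw [h3, ← mul_sub, h2, ← h1]
    push_cast
    ring
  · have h1 : Tendsto (fun τ : ℝ => -a * τ) atBot atBot :=
      tendsto_id.const_mul_atBot (by linarith)
    simpa using (Real.tendsto_exp_atBot.comp h1).const_mul (Real.exp x)
  · intro w hw _
    rw [norm_mul]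
    refine mul_le_mul (norm_exp_mul_exp_le hx hw) ?_ (norm_nonneg _) (Real.exp_pos _).le
    rw [Complex.norm_exp]
    simp

/-- The mean value property of `z ↦ e ^ (x z)`. -/
theorem arcIntegral_zero {x : ℝ} (hx : 0 < x) (ρ : ℝ) :
    arcIntegral x ρ 0 = ((2 * Real.pi : ℝ) : ℂ) := by
  have key := integral_jump_add_integral_edge_eq_zero (ρ := ρ)
    (F := fun w => Complex.exp (x * Complex.exp w) - 1) (φ := fun _ => 0)
    (B := fun τ => x * Real.exp τ * Real.exp (x * Real.exp τ)) (by fun_prop) (by fun_prop)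
    (by simp) ?_ ?_ ?_
  · rw [intervalIntegral.integral_sub
      (Continuous.intervalIntegrable (by fun_prop) _ _) (by simp)] at key
    have h : Complex.I * arcIntegral x ρ 0 = Complex.I * ((2 * Real.pi : ℝ) : ℂ) := by
      simp only [arcIntegral, Complex.ofReal_zero, zero_mul, neg_zero, Complex.exp_zero, mul_one]
      simp at key
      push_cast
      linear_combination Complex.I * key
    exact mul_left_cancel₀ Complex.I_ne_zero h
  · intro τ
    simp only [Complex.exp_ofReal_add_pi_mul_I, Complex.exp_ofReal_add_neg_pi_mul_I]
    simp
  · have h := (Real.tendsto_exp_atBot.const_mul x)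
    rw [mul_zero] at h
    simpa using h.mul (Real.continuous_exp.continuousAt.tendsto.comp h)
  · intro w _ _
    have h := Complex.norm_exp_sub_sum_le_norm_mul_exp (x * Complex.exp w) 1
    simpa [Complex.norm_exp, abs_of_pos hx] using h

/-- Integration by parts along the arc. -/
theorem mul_arcIntegral (x ρ a : ℝ) :
    a * arcIntegral x ρ a = x * arcIntegral x ρ (a - 1) +
      ((2 * Real.sin (Real.pi * a) * (Real.exp (-(x * Real.exp ρ)) * Real.exp ρ ^ (-a)) : ℝ) : ℂ) := by
  have hd : ∀ y : ℝ, HasDerivAt (fun y : ℝ => Complex.exp (x * Complex.exp (ρ + y * Complex.I)) *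
      Complex.exp (-(a * (ρ + y * Complex.I))))
      (Complex.I * (x * (Complex.exp (x * Complex.exp (ρ + y * Complex.I)) *
        Complex.exp (-(((a - 1 : ℝ) : ℂ) * (ρ + y * Complex.I)))) -
        a * (Complex.exp (x * Complex.exp (ρ + y * Complex.I)) *
        Complex.exp (-(a * (ρ + y * Complex.I)))))) y := by
    intro y
    have h0 : HasDerivAt (fun y : ℝ => (ρ : ℂ) + y * Complex.I) Complex.I y := by
      simpa using ((Complex.ofRealCLM.hasDerivAt (x := y)).mul_const Complex.I).const_add (ρ : ℂ)
    have h1 := (h0.cexp.const_mul (x : ℂ)).cexp.mul ((h0.const_mul (a : ℂ)).neg.cexp)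
    refine h1.congr_deriv ?_
    rw [show -(((a - 1 : ℝ) : ℂ) * (ρ + y * Complex.I)) =
      (ρ + y * Complex.I) + -(a * (ρ + y * Complex.I)) by push_cast; ring,
      Complex.exp_add _ (-(a * (ρ + y * Complex.I)))]
    simp only [Pi.neg_apply]
    ring
  have hftc := intervalIntegral.integral_eq_sub_of_hasDerivAt
    (a := -Real.pi) (b := Real.pi) (fun y _ => hd y)
    (Continuous.intervalIntegrable (by fun_prop) _ _)
  rw [intervalIntegral.integral_const_mul, intervalIntegral.integral_sub
    (Continuous.intervalIntegrable (by fun_prop) _ _)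
    (Continuous.intervalIntegrable (by fun_prop) _ _),
    intervalIntegral.integral_const_mul, intervalIntegral.integral_const_mul] at hftc
  change Complex.I * (x * arcIntegral x ρ (a - 1) - a * arcIntegral x ρ a) = _ at hftc
  rw [Complex.exp_ofReal_add_pi_mul_I, Complex.exp_ofReal_add_neg_pi_mul_I, ← mul_sub] at hftc
  have h2 : Complex.exp (-(a * (ρ + (Real.pi : ℂ) * Complex.I))) -
      Complex.exp (-(a * (ρ + ((-Real.pi : ℝ) : ℂ) * Complex.I))) =
      Real.exp (-(a * ρ)) * (-2 * Complex.I * Real.sin (Real.pi * a)) := by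
    rw [Complex.ofReal_sin, Complex.sin,
      show -((a : ℂ) * (ρ + ((-Real.pi : ℝ) : ℂ) * Complex.I)) =
        -(a * ρ) + (Real.pi * a) * Complex.I by push_cast; ring,
      show -((a : ℂ) * (ρ + (Real.pi : ℂ) * Complex.I)) =
        -(a * ρ) + -(Real.pi * a) * Complex.I by ring,
      Complex.exp_add, Complex.exp_add]
    push_cast
    ring_nf
    rw [Complex.I_sq]
    ring
  have h3 : Complex.exp (x * -(Real.exp ρ : ℂ)) = (Real.exp (-(x * Real.exp ρ)) : ℝ) := by
    push_cast
    ring_nf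
  have h4 : Real.exp ρ ^ (-a) = Real.exp (-(a * ρ)) := by
    rw [← Real.exp_mul]; ring_nf
  rw [h2, h3] at hftc
  rw [h4]
  refine mul_left_cancel₀ Complex.I_ne_zero ?_
  push_cast at hftc ⊢
  linear_combination -hftc

theorem mul_integral_exp_neg_mul_rpow_Ioi {x R a : ℝ} (hx : 0 < x) (hR : 0 < R) :
    a * (∫ t in Ioi R, Real.exp (-(x * t)) * t ^ (-a - 1)) =
      Real.exp (-(x * R)) * R ^ (-a) - x * ∫ t in Ioi R, Real.exp (-(x * t)) * t ^ (-a) := by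
  have hi1 := integrableOn_exp_neg_mul_rpow_Ioi hx hR (-a - 1)
  have hi2 := integrableOn_exp_neg_mul_rpow_Ioi hx hR (-a)
  have hlim : Tendsto (fun t : ℝ => Real.exp (-(x * t)) * t ^ (-a)) atTop (𝓝 0) := by
    refine (tendsto_rpow_mul_exp_neg_mul_atTop_nhds_zero (-a) x hx).congr fun t => ?_
    rw [mul_comm, neg_mul]
  have hd : ∀ t ∈ Ici R, HasDerivAt (fun t : ℝ => Real.exp (-(x * t)) * t ^ (-a))
      ((-x) * (Real.exp (-(x * t)) * t ^ (-a)) +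
        (-a) * (Real.exp (-(x * t)) * t ^ (-a - 1))) t := by
    intro t ht
    have ht0 : 0 < t := hR.trans_le ht
    have h1 : HasDerivAt (fun t : ℝ => Real.exp (-(x * t))) (Real.exp (-(x * t)) * -x) t := by
      simpa using ((hasDerivAt_id t).const_mul x).neg.exp
    refine (h1.mul (Real.hasDerivAt_rpow_const (p := -a) (Or.inl ht0.ne'))).congr_deriv ?_
    ring
  have h := integral_Ioi_of_hasDerivAt_of_tendsto' hd ((hi2.const_mul _).add (hi1.const_mul _)) hlim
  rw [integral_add (hi2.const_mul _) (hi1.const_mul _), integral_const_mul, integral_const_mul] at h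
  linear_combination -h

/-- Hankel's formula `x ^ a / Γ(a + 1) = (2πi)⁻¹ ∫ e ^ (x z) z ^ (-a - 1) dz`, with the contour consisting of
the circle of radius `e ^ ρ` and both sides of the cut outside it. The recursion
`a Γ(a) = Γ(a + 1)` reduces it to `-1 < a ≤ 0`. -/
theorem arcIntegral_eq {x ρ a : ℝ} (hx : 0 < x) (ha : -1 < a) :
    arcIntegral x ρ a = ((2 * Real.sin (Real.pi * a) *
      (∫ t in Ioi (Real.exp ρ), Real.exp (-(x * t)) * t ^ (-a - 1)) +
        2 * Real.pi * (x ^ a / Real.Gamma (a + 1)) : ℝ) : ℂ) := by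
  suffices H : ∀ n : ℕ, ∀ a : ℝ, -1 < a → a ≤ n → arcIntegral x ρ a =
      ((2 * Real.sin (Real.pi * a) *
      (∫ t in Ioi (Real.exp ρ), Real.exp (-(x * t)) * t ^ (-a - 1)) +
        2 * Real.pi * (x ^ a / Real.Gamma (a + 1)) : ℝ) : ℂ) from
    H ⌈a⌉₊ a ha (Nat.le_ceil a)
  intro n
  induction n with
  | zero =>
    intro a ha ha0
    rcases lt_or_eq_of_le ha0 with h | rfl
    · exact arcIntegral_of_neg hx ha (by simpa using h)
    · simp [arcIntegral_zero hx]
  | succ n ih =>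
    intro a ha han
    rcases le_or_gt a 0 with h0 | h0
    · exact ih a ha (h0.trans (Nat.cast_nonneg n))
    have hprev := ih (a - 1) (by linarith) (by push_cast at han; linarith)
    have hrec := mul_arcIntegral x ρ a
    have hpart := mul_integral_exp_neg_mul_rpow_Ioi (a := a) hx (Real.exp_pos ρ)
    have hsin : Real.sin (Real.pi * (a - 1)) = -Real.sin (Real.pi * a) := by
      rw [mul_sub, mul_one, Real.sin_sub_pi]
    rw [hprev, hsin, show -(a - 1) - 1 = -a by ring, sub_add_cancel,
      Real.rpow_sub_one hx.ne'] at hrec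
    refine mul_left_cancel₀ (Complex.ofReal_ne_zero.2 h0.ne') ?_
    rw [hrec, Real.Gamma_add_one h0.ne']
    norm_cast
    have hG := (Real.Gamma_pos_of_pos h0).ne'
    have e1 : x * (2 * Real.pi * (x ^ a / x / Real.Gamma a)) =
        a * (2 * Real.pi * (x ^ a / (a * Real.Gamma a))) := by
      have := h0.ne'
      field_simp
    linear_combination e1 - 2 * Real.sin (Real.pi * a) * hpart

/-! ### The kernel `k_α` -/

theorem mlKernel_denom_eq (α : ℝ) {t : ℝ} (ht : 0 ≤ t) :
    t ^ (2 * α) - 2 * Real.cos (Real.pi * α) * t ^ α + 1 =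
      (t ^ α - Real.cos (Real.pi * α)) ^ 2 + Real.sin (Real.pi * α) ^ 2 := by
  rw [mul_comm 2 α, Real.rpow_mul ht, Real.rpow_two]
  linear_combination -(Real.sin_sq_add_cos_sq (Real.pi * α))

theorem measurable_mlKernel (α : ℝ) : Measurable (mlKernel α) := by
  unfold mlKernel
  fun_prop

theorem mlKernel_nonneg {α t : ℝ} (hα : 0 ≤ α) (hα1 : α ≤ 1) (ht : 0 ≤ t) : 0 ≤ mlKernel α t := by
  have hs : 0 ≤ Real.sin (Real.pi * α) :=
    Real.sin_nonneg_of_nonneg_of_le_pi (by positivity) (by nlinarith [Real.pi_pos])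
  rw [mlKernel, mlKernel_denom_eq α ht]
  positivity

theorem mlKernel_nonpos {α t : ℝ} (hα : 1 ≤ α) (hα2 : α ≤ 2) (ht : 0 ≤ t) : mlKernel α t ≤ 0 := by
  have hs : Real.sin (Real.pi * α) ≤ 0 := by
    have h := Real.sin_nonneg_of_nonneg_of_le_pi (x := Real.pi * α - Real.pi)
      (by nlinarith [Real.pi_pos]) (by nlinarith [Real.pi_pos])
    rw [Real.sin_sub_pi] at h
    linarith
  rw [mlKernel, mlKernel_denom_eq α ht]
  exact div_nonpos_of_nonpos_of_nonneg
    (mul_nonpos_of_nonpos_of_nonneg hs (Real.rpow_nonneg ht _)) (by positivity)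

theorem mlKernel_one (t : ℝ) : mlKernel 1 t = 0 := by
  simp [mlKernel]

theorem continuousOn_mlKernel {α : ℝ} : ContinuousOn (mlKernel α) (Ioi 0) := by
  by_cases hs : Real.sin (Real.pi * α) = 0
  · have : mlKernel α = fun _ => 0 := by
      ext t
      simp [mlKernel, hs]
    rw [this]
    exact continuousOn_const
  have hr : ∀ p : ℝ, ContinuousOn (fun t : ℝ => t ^ p) (Ioi 0) := fun p t ht =>
    (Real.continuousAt_rpow_const _ _ (Or.inl (ne_of_gt ht))).continuousWithinAt
  unfold mlKernel
  refine ContinuousOn.div ((hr _).const_mul _) (continuousOn_const.mul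
    (((hr _).sub ((hr _).const_mul _)).add continuousOn_const)) fun t ht => ?_
  rw [mlKernel_denom_eq α (le_of_lt ht)]
  have := Real.pi_pos
  positivity

theorem integrableOn_exp_neg_mul_mlKernel {α x : ℝ} (hα : 0 < α) (hx : 0 < x) :
    IntegrableOn (fun t => Real.exp (-(x * t)) * mlKernel α t) (Ioi 0) := by
  by_cases hs : Real.sin (Real.pi * α) = 0
  · simp [mlKernel, hs]
  have hdom := (integrableOn_rpow_mul_exp_neg_mul_rpow (p := 1) (s := α - 1) (by linarith)
    one_pos hx).const_mul
      (|Real.sin (Real.pi * α)| / (Real.pi * Real.sin (Real.pi * α) ^ 2))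
  refine hdom.mono' ?_ ((ae_restrict_iff' measurableSet_Ioi).2 (ae_of_all _ fun t ht => ?_))
  · have := measurable_mlKernel α
    fun_prop
  have ht0 : 0 < t := ht
  rw [norm_mul, Real.norm_of_nonneg (Real.exp_pos _).le, mlKernel, mlKernel_denom_eq α ht0.le,
    norm_div, norm_mul, Real.norm_of_nonneg (Real.rpow_nonneg ht0.le _), Real.rpow_one, neg_mul,
    Real.norm_of_nonneg (by positivity : 0 ≤ Real.pi *
      ((t ^ α - Real.cos (Real.pi * α)) ^ 2 + Real.sin (Real.pi * α) ^ 2)), Real.norm_eq_abs]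
  have hle : |Real.sin (Real.pi * α)| * t ^ (α - 1) / (Real.pi *
      ((t ^ α - Real.cos (Real.pi * α)) ^ 2 + Real.sin (Real.pi * α) ^ 2)) ≤
      |Real.sin (Real.pi * α)| * t ^ (α - 1) / (Real.pi * Real.sin (Real.pi * α) ^ 2) := by
    have h2 : 0 < Real.sin (Real.pi * α) ^ 2 := by positivity
    gcongr
    nlinarith [sq_nonneg (t ^ α - Real.cos (Real.pi * α))]
  calc _ ≤ Real.exp (-(x * t)) * (|Real.sin (Real.pi * α)| * t ^ (α - 1) /
        (Real.pi * Real.sin (Real.pi * α) ^ 2)) := by gcongr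
    _ = _ := by ring

/-! ### The function `z ^ α / (z ^ α - 1)` in the logarithmic coordinate -/

/-- `z ^ α / (z ^ α - 1)` at `z = e ^ w`. -/
noncomputable def poleFactor (α : ℝ) (w : ℂ) : ℂ :=
  (1 - Complex.exp (-(α * w)))⁻¹

theorem one_sub_exp_ne_zero {α : ℝ} (hα : 0 < α) {w : ℂ} (hw : |w.im| * α < 2 * Real.pi)
    (hw0 : w ≠ 0) : 1 - Complex.exp (-(α * w)) ≠ 0 := by
  intro h
  obtain ⟨n, hn⟩ := Complex.exp_eq_one_iff.1 (sub_eq_zero.1 h).symm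
  have him := congrArg Complex.im hn
  have hre := congrArg Complex.re hn
  simp at him hre
  have hn0 : n = 0 := by
    by_contra hne
    have h1 : (1 : ℝ) ≤ |(n : ℝ)| := by exact_mod_cast Int.one_le_abs hne
    have h2 : |w.im| * α = |(n : ℝ)| * (2 * Real.pi) := by
      rw [← abs_of_pos (by positivity : 0 < 2 * Real.pi), ← abs_mul, ← him, abs_neg, abs_mul,
        abs_of_pos hα, mul_comm]
    nlinarith [Real.pi_pos]
  rw [hn0] at him
  simp [hα.ne'] at him
  exact hw0 (Complex.ext (by simpa [hα.ne'] using hre) (by simpa using him))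

theorem norm_poleFactor_le {α : ℝ} (hα : 0 < α) {w : ℂ} (hw : w.re < 0) :
    ‖poleFactor α w‖ ≤ (Real.exp (-(α * w.re)) - 1)⁻¹ := by
  have h1 : 1 < Real.exp (-(α * w.re)) := Real.one_lt_exp_iff.2 (by nlinarith)
  rw [poleFactor, norm_inv]
  refine inv_anti₀ (by linarith) ?_
  have h2 := norm_sub_norm_le (Complex.exp (-(α * w))) 1
  rw [norm_sub_rev] at h2
  simpa [Complex.norm_exp] using h2

theorem tendsto_inv_exp_neg_sub_one {α : ℝ} (hα : 0 < α) :
    Tendsto (fun τ => (Real.exp (-(α * τ)) - 1)⁻¹) atBot (𝓝 0) := by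
  refine tendsto_inv_atTop_zero.comp (tendsto_atTop_add_const_right _ _ ?_)
  exact Real.tendsto_exp_atTop.comp
    (tendsto_neg_atBot_atTop.comp (tendsto_id.const_mul_atBot hα))

theorem tendsto_mul_poleFactor {α : ℝ} (hα : 0 < α) :
    Tendsto (fun w => w * poleFactor α w) (𝓝[≠] 0) (𝓝 (α : ℂ)⁻¹) := by
  have hd : HasDerivAt (fun w : ℂ => 1 - Complex.exp (-(α * w))) (α : ℂ) 0 := by
    have h := (((hasDerivAt_id (0 : ℂ)).const_mul (α : ℂ)).neg.cexp).const_sub 1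
    simpa using h
  have h := (hasDerivAt_iff_tendsto_slope.1 hd).inv₀ (Complex.ofReal_ne_zero.2 hα.ne')
  refine h.congr fun w => ?_
  simp [slope, poleFactor, mul_comm]

/-- On the strip `|Im w| ≤ π` the only pole of `poleFactor α` is a simple one at `0` with residue
`1 / α`, which is cancelled by the pole of `poleFactor 1 / α`. -/
theorem exists_regularization {α : ℝ} (hα : 0 < α) (hα2 : α < 2) :
    ∃ Q : ℂ → ℂ, DifferentiableOn ℂ Q {w | |w.im| ≤ Real.pi} ∧
      ∀ w, w ≠ 0 → Q w = poleFactor α w - (α : ℂ)⁻¹ * poleFactor 1 w := by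
  have hπ := Real.pi_pos
  set f : ℂ → ℂ := fun w => poleFactor α w - (α : ℂ)⁻¹ * poleFactor 1 w with hf
  set s : Set ℂ := {w | |w.im| * α < 2 * Real.pi ∧ |w.im| < 2 * Real.pi} with hs
  have hso : IsOpen s := by
    have hc := Complex.continuous_im.abs
    exact (isOpen_lt (hc.mul continuous_const) continuous_const).inter
      (isOpen_lt hc continuous_const)
  have hs0 : s ∈ 𝓝 (0 : ℂ) := hso.mem_nhds (by simp [hs, hπ])
  have hd : DifferentiableOn ℂ f (s \ {0}) := by
    rintro w ⟨⟨h1, h2⟩, h0⟩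
    have e1 := one_sub_exp_ne_zero hα h1 h0
    have e2 := one_sub_exp_ne_zero one_pos (by simpa using h2) h0
    refine DifferentiableAt.differentiableWithinAt ?_
    refine DifferentiableAt.sub ?_ (DifferentiableAt.const_mul ?_ _)
    · exact DifferentiableAt.inv (by fun_prop) e1
    · exact DifferentiableAt.inv (by fun_prop) e2
  have ho : (fun z => f z - f 0) =o[𝓝[≠] 0] fun z => (z - 0)⁻¹ := by
    have hlim : Tendsto (fun w => w * f w) (𝓝[≠] 0) (𝓝 0) := by
      have h := (tendsto_mul_poleFactor hα).sub
        ((tendsto_mul_poleFactor one_pos).const_mul (α : ℂ)⁻¹)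
      simp only [Complex.ofReal_one, inv_one, mul_one, sub_self] at h
      refine h.congr fun w => ?_
      simp only [hf]
      ring
    -- both factors take the value `0⁻¹ = 0` at the pole
    have hf0 : f 0 = 0 := by simp [hf, poleFactor]
    simp only [hf0, sub_zero]
    refine (Asymptotics.isLittleO_iff_tendsto' ?_).2 ?_
    · filter_upwards [self_mem_nhdsWithin] with w hw h
      exact absurd (inv_eq_zero.1 h) hw
    · refine hlim.congr fun w => ?_
      rw [div_inv_eq_mul, mul_comm]
  refine ⟨_, (Complex.differentiableOn_update_limUnder_of_isLittleO hs0 hd ho).mono ?_,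
    fun w hw => Function.update_of_ne hw _ _⟩
  intro w hw
  have hw' : |w.im| ≤ Real.pi := hw
  exact ⟨by nlinarith [abs_nonneg w.im], by linarith⟩

/-- The jump of `z ^ α / (z ^ α - 1)` across the negative axis is `2πi t k_α(t)`. -/
theorem poleFactor_jump {α : ℝ} (hα : 0 < α) (hα2 : α < 2) (τ : ℝ) :
    poleFactor α (τ + ((-Real.pi : ℝ) : ℂ) * Complex.I) -
      poleFactor α (τ + (Real.pi : ℂ) * Complex.I) =
      Real.exp τ * (2 * Real.pi * Complex.I * mlKernel α (Real.exp τ)) := by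
  have hπ := Real.pi_pos
  have hb : Real.pi * α < 2 * Real.pi := by nlinarith
  have n1 : 1 - Complex.exp (-(α * (τ + ((-Real.pi : ℝ) : ℂ) * Complex.I))) ≠ 0 := by
    refine one_sub_exp_ne_zero hα ?_ fun h => ?_
    · simpa [abs_of_pos hπ] using hb
    · have := congrArg Complex.im h
      simp [hπ.ne'] at this
  have n2 : 1 - Complex.exp (-(α * (τ + (Real.pi : ℂ) * Complex.I))) ≠ 0 := by
    refine one_sub_exp_ne_zero hα ?_ fun h => ?_
    · simpa [abs_of_pos hπ] using hb
    · have := congrArg Complex.im h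
      simp [hπ.ne'] at this
  set V : ℝ := Real.exp (α * τ) with hV
  have hV0 : V ≠ 0 := (Real.exp_pos _).ne'
  set c : ℝ := Real.cos (Real.pi * α) with hc
  set s : ℝ := Real.sin (Real.pi * α) with hs
  have hcs : (s : ℂ) ^ 2 + (c : ℂ) ^ 2 = 1 := by
    exact_mod_cast Real.sin_sq_add_cos_sq (Real.pi * α)
  have x1 : Complex.exp (-(α * (τ + ((-Real.pi : ℝ) : ℂ) * Complex.I))) =
      (V : ℂ)⁻¹ * (c + s * Complex.I) := by
    rw [show -((α : ℂ) * (τ + ((-Real.pi : ℝ) : ℂ) * Complex.I)) =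
      -((α * τ : ℝ) : ℂ) + ((Real.pi * α : ℝ) : ℂ) * Complex.I by push_cast; ring,
      Complex.exp_add, Complex.exp_mul_I, Complex.exp_neg, hV, hc, hs]
    push_cast
    ring
  have x2 : Complex.exp (-(α * (τ + (Real.pi : ℂ) * Complex.I))) =
      (V : ℂ)⁻¹ * (c - s * Complex.I) := by
    rw [show -((α : ℂ) * (τ + (Real.pi : ℂ) * Complex.I)) =
      -((α * τ : ℝ) : ℂ) + -((Real.pi * α : ℝ) : ℂ) * Complex.I by push_cast; ring,
      Complex.exp_add, Complex.exp_mul_I, Complex.exp_neg, Complex.cos_neg, Complex.sin_neg,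
      hV, hc, hs]
    push_cast
    ring
  have hk : Real.exp τ * mlKernel α (Real.exp τ) =
      s * V / (Real.pi * (V ^ 2 - 2 * c * V + 1)) := by
    have e1 : Real.exp τ ^ (2 * α) = V ^ 2 := by
      rw [hV, ← Real.exp_mul, ← Real.exp_nat_mul]
      push_cast
      ring_nf
    have e2 : Real.exp τ ^ α = V := by rw [hV, ← Real.exp_mul, mul_comm]
    have e3 : Real.exp τ * Real.exp τ ^ (α - 1) = V := by
      rw [Real.rpow_sub_one (Real.exp_pos _).ne', e2]
      field_simp
    rw [mlKernel, e1, e2, ← hc, ← hs, ← mul_div_assoc]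
    congr 1
    linear_combination s * e3
  have hkC : (Real.exp τ : ℂ) * mlKernel α (Real.exp τ) =
      s * V / (Real.pi * (V ^ 2 - 2 * c * V + 1)) := by
    exact_mod_cast congrArg ((↑) : ℝ → ℂ) hk
  have hVC : (V : ℂ) ≠ 0 := Complex.ofReal_ne_zero.2 hV0
  have hπC : (Real.pi : ℂ) ≠ 0 := Complex.ofReal_ne_zero.2 hπ.ne'
  rw [x1] at n1
  rw [x2] at n2
  have m1 : (V : ℂ) - (c + s * Complex.I) ≠ 0 := by
    intro h
    apply n1
    rw [← sub_eq_zero.1 h, inv_mul_cancel₀ hVC, sub_self]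
  have m2 : (V : ℂ) - (c - s * Complex.I) ≠ 0 := by
    intro h
    apply n2
    rw [← sub_eq_zero.1 h, inv_mul_cancel₀ hVC, sub_self]
  have hD : (V : ℂ) ^ 2 - 2 * c * V + 1 =
      ((V : ℂ) - (c + s * Complex.I)) * ((V : ℂ) - (c - s * Complex.I)) := by
    linear_combination -hcs + (s : ℂ) ^ 2 * Complex.I_sq
  have y1 : (1 - (V : ℂ)⁻¹ * (c + s * Complex.I))⁻¹ = V / (V - (c + s * Complex.I)) := by
    rw [inv_eq_iff_eq_inv, inv_div, sub_div, div_self hVC]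
    ring
  have y2 : (1 - (V : ℂ)⁻¹ * (c - s * Complex.I))⁻¹ = V / (V - (c - s * Complex.I)) := by
    rw [inv_eq_iff_eq_inv, inv_div, sub_div, div_self hVC]
    ring
  rw [poleFactor, poleFactor, x1, x2, y1, y2,
    show (Real.exp τ : ℂ) * (2 * Real.pi * Complex.I * mlKernel α (Real.exp τ)) =
      2 * Real.pi * Complex.I * (Real.exp τ * mlKernel α (Real.exp τ)) by ring, hkC, hD,
    div_sub_div _ _ m1 m2]
  field_simp
  ring

/-! ### The Laplace transform of `k_α` -/

theorem hasSum_arcIntegral {α ρ : ℝ} (x : ℝ) (hα : 0 < α) (hρ : 0 < ρ) :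
    HasSum (fun n : ℕ => arcIntegral x ρ (α * n))
      (∫ y in (-Real.pi)..Real.pi, Complex.exp (x * Complex.exp (ρ + y * Complex.I)) *
        poleFactor α (ρ + y * Complex.I)) := by
  have hq : Real.exp (-(α * ρ)) < 1 := Real.exp_lt_one_iff.2 (by nlinarith)
  have hnorm : ∀ y : ℝ, ‖Complex.exp (-(α * (ρ + y * Complex.I)))‖ = Real.exp (-(α * ρ)) :=
    fun y => by simp [Complex.norm_exp]
  have hb : ∀ y : ℝ, ‖Complex.exp (x * Complex.exp (ρ + y * Complex.I))‖ ≤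
      Real.exp (|x| * Real.exp ρ) := fun y => by
    rw [Complex.norm_exp, Complex.re_ofReal_mul]
    refine Real.exp_le_exp.2 ((le_abs_self _).trans ?_)
    rw [abs_mul]
    refine mul_le_mul_of_nonneg_left ((Complex.abs_re_le_norm _).trans ?_) (abs_nonneg x)
    simp [Complex.norm_exp]
  have hpow : ∀ (n : ℕ) (y : ℝ), Complex.exp (-(((α * n : ℝ) : ℂ) * (ρ + y * Complex.I))) =
      Complex.exp (-(α * (ρ + y * Complex.I))) ^ n := fun n y => by
    rw [← Complex.exp_nat_mul]
    push_cast
    ring_nf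
  have hsum : Summable fun n : ℕ => Real.exp (|x| * Real.exp ρ) * Real.exp (-(α * ρ)) ^ n :=
    (summable_geometric_of_lt_one (Real.exp_pos _).le hq).mul_left _
  refine intervalIntegral.hasSum_integral_of_dominated_convergence
    (fun n _ => Real.exp (|x| * Real.exp ρ) * Real.exp (-(α * ρ)) ^ n) (fun n => ?_) (fun n => ?_)
    (ae_of_all _ fun y _ => hsum) (by simp) (ae_of_all _ fun y _ => ?_)
  · exact Continuous.aestronglyMeasurable (by fun_prop)
  · refine ae_of_all _ fun y _ => ?_
    rw [norm_mul, hpow, norm_pow, hnorm]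
    gcongr
    exact hb y
  · have hz : ‖Complex.exp (-(α * (ρ + y * Complex.I)))‖ < 1 := by rwa [hnorm]
    simp only [hpow, poleFactor]
    exact HasSum.mul_left _ (hasSum_geometric_of_norm_lt_one hz)

theorem continuous_poleFactor_edge {α ρ : ℝ} (hα : 0 < α) (hρ : 0 < ρ) :
    Continuous fun y : ℝ => poleFactor α (ρ + y * Complex.I) := by
  refine Continuous.inv₀ (by fun_prop) fun y h => ?_
  have h1 := congrArg norm (sub_eq_zero.1 h)
  have h2 : Real.exp (-(α * ρ)) < 1 := Real.exp_lt_one_iff.2 (by nlinarith)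
  rw [Complex.norm_exp, norm_one, show (-((α : ℂ) * (ρ + y * Complex.I))).re = -(α * ρ) by simp]
    at h1
  linarith

theorem hasSum_sin_mul_pow (θ : ℝ) {v : ℝ} (hv0 : 0 ≤ v) (hv : v < 1) :
    HasSum (fun n : ℕ => Real.sin (θ * n) * v ^ n)
      (v * Real.sin θ / (1 - 2 * Real.cos θ * v + v ^ 2)) := by
  set z : ℂ := v * Complex.exp (θ * Complex.I) with hz
  have hzn : ‖z‖ < 1 := by
    rw [hz, norm_mul, Complex.norm_exp_ofReal_mul_I, mul_one, Complex.norm_of_nonneg hv0]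
    exact hv
  have h := Complex.hasSum_im (hasSum_geometric_of_norm_lt_one hzn)
  have hre : z.re = v * Real.cos θ := by
    rw [hz, Complex.re_ofReal_mul, Complex.exp_ofReal_mul_I_re]
  have him : z.im = v * Real.sin θ := by
    rw [hz, Complex.im_ofReal_mul, Complex.exp_ofReal_mul_I_im]
  have hval : ((1 - z)⁻¹).im = v * Real.sin θ / (1 - 2 * Real.cos θ * v + v ^ 2) := by
    rw [Complex.inv_im, Complex.normSq_apply]
    simp only [Complex.sub_re, Complex.sub_im, Complex.one_re, Complex.one_im, hre, him, zero_sub,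
      neg_neg]
    congr 1
    linear_combination v ^ 2 * Real.sin_sq_add_cos_sq θ
  rw [hval] at h
  refine h.congr_fun fun n => ?_
  rw [hz, mul_pow, ← Complex.ofReal_pow, Complex.im_ofReal_mul, ← Complex.exp_nat_mul,
    show (n : ℂ) * (θ * Complex.I) = ((θ * n : ℝ) : ℂ) * Complex.I by push_cast; ring,
    Complex.exp_ofReal_mul_I_im]
  ring

/-- Outside the unit disc, `k_α` is the sum of the jumps of the functions `z ^ (-α n - 1)`. -/
theorem hasSum_sin_mul_rpow {α t : ℝ} (hα : 0 < α) (ht : 1 < t) :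
    HasSum (fun n : ℕ => Real.sin (Real.pi * (α * n)) * t ^ (-(α * n) - 1))
      (Real.pi * mlKernel α t) := by
  have ht0 : 0 < t := by linarith
  have h := (hasSum_sin_mul_pow (Real.pi * α) (v := t ^ (-α)) (Real.rpow_nonneg ht0.le _)
    (Real.rpow_lt_one_of_one_lt_of_neg ht (by linarith))).mul_right t⁻¹
  have hV := Real.rpow_pos_of_pos ht0 α
  have hval : Real.pi * mlKernel α t = t ^ (-α) * Real.sin (Real.pi * α) /
      (1 - 2 * Real.cos (Real.pi * α) * t ^ (-α) + (t ^ (-α)) ^ 2) * t⁻¹ := by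
    have e1 : t ^ (2 * α) = (t ^ α) ^ 2 := by
      rw [mul_comm, Real.rpow_mul ht0.le, Real.rpow_two]
    rw [mlKernel, e1, Real.rpow_neg ht0.le, Real.rpow_sub_one ht0.ne']
    have hD : 1 - 2 * Real.cos (Real.pi * α) * (t ^ α)⁻¹ + ((t ^ α)⁻¹) ^ 2 =
        ((t ^ α) ^ 2 - 2 * Real.cos (Real.pi * α) * t ^ α + 1) / (t ^ α) ^ 2 := by
      field_simp
    rw [hD]
    have := Real.pi_pos.ne'
    field_simp
  rw [hval]
  refine h.congr_fun fun n => ?_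
  rw [Real.rpow_sub_one ht0.ne', ← Real.rpow_natCast, ← Real.rpow_mul ht0.le]
  ring_nf

theorem hasSum_integral_tail {α x ρ : ℝ} (hα : 0 < α) (hx : 0 < x) (hρ : 0 < ρ) :
    HasSum (fun n : ℕ => Real.sin (Real.pi * (α * n)) *
        ∫ t in Ioi (Real.exp ρ), Real.exp (-(x * t)) * t ^ (-(α * n) - 1))
      (Real.pi * ∫ t in Ioi (Real.exp ρ), Real.exp (-(x * t)) * mlKernel α t) := by
  set R := Real.exp ρ with hR
  have hR1 : 1 < R := Real.one_lt_exp_iff.2 hρ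
  have hR0 : 0 < R := by linarith
  set F : ℕ → ℝ → ℝ := fun n t => Real.sin (Real.pi * (α * n)) *
    (Real.exp (-(x * t)) * t ^ (-(α * n) - 1)) with hF
  have hFi : ∀ n, IntegrableOn (F n) (Ioi R) := fun n =>
    (integrableOn_exp_neg_mul_rpow_Ioi hx hR0 _).const_mul _
  have hexp : IntegrableOn (fun t : ℝ => Real.exp (-(x * t))) (Ioi R) := by
    simpa using integrableOn_exp_mul_Ioi (neg_lt_zero.2 hx) R
  have hle : ∀ n : ℕ, ∀ t ∈ Ioi R, ‖F n t‖ ≤ Real.exp (-(x * t)) * (R ^ (-α)) ^ n := by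
    intro n t ht
    have ht0 : 0 < t := hR0.trans ht
    have h1 : t ^ (-(α * n) - 1) ≤ (R ^ (-α)) ^ n := by
      rw [← Real.rpow_natCast, ← Real.rpow_mul hR0.le, neg_mul]
      calc t ^ (-(α * n) - 1) ≤ R ^ (-(α * n) - 1) :=
            Real.rpow_le_rpow_of_nonpos hR0 (le_of_lt ht)
              (by have : 0 ≤ α * n := by positivity
                  linarith)
        _ ≤ R ^ (-(α * n)) := Real.rpow_le_rpow_of_exponent_le hR1.le (by linarith)
    rw [norm_mul, norm_mul, Real.norm_of_nonneg (Real.exp_pos _).le,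
      Real.norm_of_nonneg (Real.rpow_nonneg ht0.le _)]
    have h2 : ‖Real.sin (Real.pi * (α * n))‖ ≤ 1 := Real.abs_sin_le_one _
    calc _ ≤ 1 * (Real.exp (-(x * t)) * (R ^ (-α)) ^ n) := by gcongr
      _ = _ := one_mul _
  have hsum : Summable fun n => ∫ t in Ioi R, ‖F n t‖ := by
    have hg : Summable fun n : ℕ => (∫ t in Ioi R, Real.exp (-(x * t))) * (R ^ (-α)) ^ n :=
      (summable_geometric_of_lt_one (Real.rpow_nonneg hR0.le _)
        (Real.rpow_lt_one_of_one_lt_of_neg hR1 (by linarith))).mul_left _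
    refine hg.of_nonneg_of_le (fun n => integral_nonneg fun t => norm_nonneg _) fun n => ?_
    rw [← integral_mul_const]
    exact setIntegral_mono_on (hFi n).norm (hexp.mul_const _) measurableSet_Ioi (hle n)
  have h := hasSum_integral_of_summable_integral_norm hFi hsum
  have hval : ∫ t in Ioi R, ∑' n, F n t = Real.pi * ∫ t in Ioi R, Real.exp (-(x * t)) *
      mlKernel α t := by
    rw [← integral_const_mul]
    refine setIntegral_congr_fun measurableSet_Ioi fun t ht => ?_
    have h1 := ((hasSum_sin_mul_rpow hα (hR1.trans ht)).mul_left (Real.exp (-(x * t)))).tsum_eq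
    simp only [hF]
    calc _ = ∑' n : ℕ, Real.exp (-(x * t)) *
          (Real.sin (Real.pi * (α * n)) * t ^ (-(α * n) - 1)) :=
          tsum_congr fun n => by ring
      _ = _ := by rw [h1]; ring
  rw [hval] at h
  refine h.congr_fun fun n => ?_
  simp only [hF]
  rw [integral_const_mul]

/-- Hankel's formula summed over the Mittag-Leffler series. -/
theorem integral_edge_eq {α x ρ : ℝ} (hα : 0 < α) (hx : 0 < x) (hρ : 0 < ρ) :
    ∫ y in (-Real.pi)..Real.pi, Complex.exp (x * Complex.exp (ρ + y * Complex.I)) *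
        poleFactor α (ρ + y * Complex.I) =
      ((2 * Real.pi * (∫ t in Ioi (Real.exp ρ), Real.exp (-(x * t)) * mlKernel α t) +
        2 * Real.pi * mlF α 1 x : ℝ) : ℂ) := by
  refine (hasSum_arcIntegral x hα hρ).unique ?_
  have hs : HasSum (fun n : ℕ => x ^ (α * n) / Real.Gamma (α * n + 1)) (mlF α 1 x) := by
    rw [mlF_eq_tsum hx.le]
    simpa using (summable_rpow_div_Gamma hα hx 0 1).hasSum
  have h := ((hasSum_integral_tail hα hx hρ).mul_left 2).add (hs.mul_left (2 * Real.pi))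
  rw [← mul_assoc] at h
  refine (Complex.hasSum_ofReal.2 h).congr_fun fun n => ?_
  rw [arcIntegral_eq hx (by have : 0 ≤ α * n := by positivity
                            linarith)]
  push_cast
  ring

theorem mlF_one_one {x : ℝ} (hx : 0 ≤ x) : mlF 1 1 x = Real.exp x := by
  rw [mlF_eq_tsum hx, Real.exp_eq_exp_ℝ, NormedSpace.exp_eq_tsum_div]
  refine tsum_congr fun n => ?_
  rw [one_mul, Real.Gamma_nat_eq_factorial, Real.rpow_natCast]

/-- The contour integral representation of `E_α(x ^ α)`, with the contour collapsed onto the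
negative axis and the residue at `z = 1` collected. -/
theorem integral_exp_neg_mul_mlKernel {α x : ℝ} (hα : 0 < α) (hα2 : α < 2) (hx : 0 < x) :
    ∫ t in Ioi (0 : ℝ), Real.exp (-(x * t)) * mlKernel α t = Real.exp x / α - mlF α 1 x := by
  have hπ := Real.pi_pos
  obtain ⟨Q, hQd, hQ⟩ := exists_regularization hα hα2
  have hR := Real.exp_pos 1
  have hki := integrableOn_exp_neg_mul_mlKernel hα hx
  have hkii : IntervalIntegrable (fun t => Real.exp (-(x * t)) * mlKernel α t) volume 0
      (Real.exp 1) :=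
    (intervalIntegrable_iff_integrableOn_Ioc_of_le hR.le).2 (hki.mono_set Ioc_subset_Ioi_self)
  have hne : ∀ (ρ : ℝ) (s : ℂ), ρ ≠ 0 ∨ s.im ≠ 0 → s.re = 0 → (ρ : ℂ) + s ≠ 0 := by
    intro ρ s h h0 he
    have h1 := congrArg Complex.re he
    have h2 := congrArg Complex.im he
    simp [h0] at h1 h2
    tauto
  have key := integral_jump_add_integral_edge_eq_zero (ρ := 1)
    (F := fun w => Complex.exp (x * Complex.exp w) * Q w)
    (φ := fun t => 2 * Real.pi * Complex.I * ((Real.exp (-(x * t)) * mlKernel α t : ℝ) : ℂ))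
    (B := fun τ => Real.exp x * ((Real.exp (-(α * τ)) - 1)⁻¹ +
      α⁻¹ * (Real.exp (-(1 * τ)) - 1)⁻¹)) ?_ ?_ ?_ ?_ ?_ ?_
  -- at `α = 1` the kernel vanishes, so the edge integral is just `2π e ^ x`
  · have hedge : ∫ y in (-Real.pi)..Real.pi,
        Complex.exp (x * Complex.exp (((1 : ℝ) : ℂ) + y * Complex.I)) *
          Q (((1 : ℝ) : ℂ) + y * Complex.I) =
        ((2 * Real.pi * (∫ t in Ioi (Real.exp 1), Real.exp (-(x * t)) * mlKernel α t) +
        2 * Real.pi * mlF α 1 x : ℝ) : ℂ) - (α : ℂ)⁻¹ * ((2 * Real.pi * Real.exp x : ℝ) : ℂ) := by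
      have h1 := integral_edge_eq (ρ := 1) one_pos hx one_pos
      simp only [mlKernel_one, mul_zero, integral_zero, zero_add, mlF_one_one hx.le] at h1
      rw [← integral_edge_eq hα hx one_pos, ← h1, ← intervalIntegral.integral_const_mul,
        ← intervalIntegral.integral_sub]
      · refine intervalIntegral.integral_congr fun y _ => ?_
        rw [hQ _ (hne 1 _ (Or.inl one_ne_zero) (by simp))]
        push_cast
        ring
      · have := continuous_poleFactor_edge hα one_pos
        exact Continuous.intervalIntegrable (by fun_prop) _ _
      · have := continuous_poleFactor_edge one_pos one_pos
        exact Continuous.intervalIntegrable (by fun_prop) _ _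
    rw [intervalIntegral.integral_const_mul, intervalIntegral.integral_ofReal, hedge] at key
    have hsplit := intervalIntegral.integral_interval_add_Ioi (a := 0) (b := Real.exp 1) hki
      (hki.mono_set (Ioi_subset_Ioi hR.le))
    rw [← hsplit]
    have key2 : 2 * Real.pi * Complex.I *
        (((∫ t in (0 : ℝ)..Real.exp 1, Real.exp (-(x * t)) * mlKernel α t) +
        (∫ t in Ioi (Real.exp 1), Real.exp (-(x * t)) * mlKernel α t) + mlF α 1 x -
          Real.exp x / α : ℝ) : ℂ) = 0 := by
      rw [← key]
      push_cast
      ring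
    have h2 : (2 * Real.pi * Complex.I : ℂ) ≠ 0 := by simp [hπ.ne']
    have h3 := (mul_eq_zero.1 key2).resolve_left h2
    have h4 := Complex.ofReal_eq_zero.1 h3
    linarith
  · exact DifferentiableOn.mul (by fun_prop) hQd
  · refine continuousOn_const.mul (Complex.continuous_ofReal.comp_continuousOn ?_)
    exact ContinuousOn.mul (by fun_prop) continuousOn_mlKernel
  · exact IntervalIntegrable.const_mul ⟨hkii.1.ofReal, hkii.2.ofReal⟩ _
  · intro τ
    have j1 := poleFactor_jump hα hα2 τ
    have j2 := poleFactor_jump one_pos one_lt_two τ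
    rw [mlKernel_one, Complex.ofReal_zero, mul_zero, mul_zero] at j2
    rw [hQ _ (hne τ _ (Or.inr (by simp [hπ.ne'])) (by simp)),
      hQ _ (hne τ _ (Or.inr (by simp [hπ.ne'])) (by simp)),
      Complex.exp_ofReal_add_pi_mul_I, Complex.exp_ofReal_add_neg_pi_mul_I]
    have h3 : Complex.exp (x * -(Real.exp τ : ℂ)) = (Real.exp (-(x * Real.exp τ)) : ℝ) := by
      push_cast
      ring_nf
    rw [h3, Complex.ofReal_mul]
    linear_combination (Real.exp (-(x * Real.exp τ)) : ℂ) * j1 -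
      (Real.exp (-(x * Real.exp τ)) : ℂ) * (α : ℂ)⁻¹ * j2
  · have h := ((tendsto_inv_exp_neg_sub_one hα).add
      ((tendsto_inv_exp_neg_sub_one one_pos).const_mul α⁻¹)).const_mul (Real.exp x)
    simpa using h
  · intro w hw _
    have hw0 : w ≠ 0 := by
      rintro rfl
      simp at hw
    rw [norm_mul, hQ w hw0]
    refine mul_le_mul (norm_exp_mul_exp_le hx hw) ?_ (norm_nonneg _) (Real.exp_pos _).le
    refine (norm_sub_le _ _).trans (add_le_add (norm_poleFactor_le hα hw) ?_)
    rw [norm_mul, norm_inv, Complex.norm_of_nonneg hα.le]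
    exact mul_le_mul_of_nonneg_left (norm_poleFactor_le one_pos hw) (by positivity)

/-! ### Reduction of general `β` to `β = 1` -/

theorem deriv_mlF_one {α x : ℝ} (hα : 0 < α) (hx : 0 < x) :
    deriv (mlF α 1) x = ∑' n : ℕ, x ^ (α * n + α - 1) / Real.Gamma (α * n + α) := by
  have h := diffDiffOp_mlF (β := 1) hα le_rfl hx
  simpa [diffDiffOp] using h

theorem average_mlF {α β x : ℝ} (hα : 0 < α) (hβ : 1 < β) (hx : 0 < x) :
    IntegrableOn (fun u : ℝ => (1 - u) ^ (β - 2) * mlF α 1 (x * u)) (Ioo 0 1) ∧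
      ∫ u in Ioo (0 : ℝ) 1, (1 - u) ^ (β - 2) * mlF α 1 (x * u) =
        Real.Gamma (β - 1) * mlF α β x := by
  have he : EqOn (fun u : ℝ => (1 - u) ^ (β - 2) *
      ∑' n : ℕ, (x * u) ^ (α * n + 1 - 1) / Real.Gamma (α * n + 1))
      (fun u : ℝ => (1 - u) ^ (β - 2) * mlF α 1 (x * u)) (Ioo 0 1) := fun u hu => by
    simp only [add_sub_cancel_right]
    rw [mlF_eq_tsum (mul_pos hx hu.1).le]
  refine ⟨(integrableOn_one_sub_rpow_mul_tsum hα one_pos hβ hx).congr_fun he measurableSet_Ioo, ?_⟩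
  rw [← setIntegral_congr_fun measurableSet_Ioo he,
    integral_one_sub_rpow_mul_tsum hα one_pos hβ hx, mlF_eq_tsum hx.le]
  congr 1
  refine tsum_congr fun n => ?_
  ring_nf

theorem average_deriv_mlF {α β x : ℝ} (hα : 0 < α) (hβ : 1 < β) (hx : 0 < x) :
    IntegrableOn (fun u : ℝ => (1 - u) ^ (β - 2) * deriv (mlF α 1) (x * u)) (Ioo 0 1) ∧
      ∫ u in Ioo (0 : ℝ) 1, (1 - u) ^ (β - 2) * deriv (mlF α 1) (x * u) =
        Real.Gamma (β - 1) * diffDiffOp β (mlF α β) x := by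
  have he : EqOn (fun u : ℝ => (1 - u) ^ (β - 2) *
      ∑' n : ℕ, (x * u) ^ (α * n + α - 1) / Real.Gamma (α * n + α))
      (fun u : ℝ => (1 - u) ^ (β - 2) * deriv (mlF α 1) (x * u)) (Ioo 0 1) := fun u hu => by
    beta_reduce
    rw [deriv_mlF_one hα (mul_pos hx hu.1)]
  refine ⟨(integrableOn_one_sub_rpow_mul_tsum hα hα hβ hx).congr_fun he measurableSet_Ioo, ?_⟩
  rw [← setIntegral_congr_fun measurableSet_Ioo he,
    integral_one_sub_rpow_mul_tsum hα hα hβ hx, diffDiffOp_mlF hα hβ.le hx]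

theorem average_exp_sub_mlF {α β x : ℝ} (hα : 0 < α) (hβ : 1 < β) (hx : 0 < x) :
    IntegrableOn (fun u : ℝ => (1 - u) ^ (β - 2) * (Real.exp (x * u) / α - mlF α 1 (x * u)))
        (Ioo 0 1) ∧
      1 / Real.Gamma (β - 1) * ∫ u in Ioo (0 : ℝ) 1, (1 - u) ^ (β - 2) *
        (Real.exp (x * u) / α - mlF α 1 (x * u)) = expTerm α β x - mlF α β x := by
  obtain ⟨h1, h2⟩ := average_mlF hα hβ hx
  have h3 : IntegrableOn (fun u : ℝ => (1 - u) ^ (β - 2) * (Real.exp (x * u) / α)) (Ioo 0 1) := by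
    simpa only [IntegrableOn, mul_div_assoc] using (integrableOn_one_sub_rpow_mul_exp hβ x).div_const α
  simp_rw [mul_sub]
  refine ⟨h3.sub h1, ?_⟩
  rw [integral_sub h3 h1, h2, mul_sub, ← expTerm_eq_integral hx]
  have := (Real.Gamma_pos_of_pos (sub_pos.2 hβ)).ne'
  field_simp

theorem average_deriv_mlF_sub_exp {α β x : ℝ} (hα : 0 < α) (hβ : 1 < β) (hx : 0 < x) :
    IntegrableOn (fun u : ℝ => (1 - u) ^ (β - 2) *
        (deriv (mlF α 1) (x * u) - Real.exp (x * u) / α)) (Ioo 0 1) ∧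
      1 / Real.Gamma (β - 1) * ∫ u in Ioo (0 : ℝ) 1, (1 - u) ^ (β - 2) *
        (deriv (mlF α 1) (x * u) - Real.exp (x * u) / α) =
          diffDiffOp β (mlF α β) x - expTerm α β x := by
  obtain ⟨h1, h2⟩ := average_deriv_mlF hα hβ hx
  have h3 : IntegrableOn (fun u : ℝ => (1 - u) ^ (β - 2) * (Real.exp (x * u) / α)) (Ioo 0 1) := by
    simpa only [IntegrableOn, mul_div_assoc] using (integrableOn_one_sub_rpow_mul_exp hβ x).div_const α
  simp_rw [mul_sub]
  refine ⟨h1.sub h3, ?_⟩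
  rw [integral_sub h1 h3, h2, mul_sub, ← expTerm_eq_integral hx]
  have := (Real.Gamma_pos_of_pos (sub_pos.2 hβ)).ne'
  field_simp

/-- The passage from `β = 1` to `β > 1`. The factor `σ = ±1` covers both signs of `k_α`. -/
theorem hasBernsteinDensity_of_one {α β σ : ℝ} {g : ℝ → ℝ} (hα : 0 < α) (hβ : 1 < β)
    (hg : Measurable g)
    (h : HasBernsteinDensity (fun x => σ * (Real.exp x / α - mlF α 1 x)) g) :
    HasBernsteinDensity (fun x => σ * (expTerm α β x - mlF α β x)) (betaTransform β g) ∧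
      HasBernsteinDensity (fun x => σ * (diffDiffOp β (mlF α β) x - expTerm α β x))
        (betaTransform β fun t => t * g t) := by
  have hderiv : EqOn (fun x => σ * (deriv (mlF α 1) x - Real.exp x / α))
      (fun x => -deriv (fun x => σ * (Real.exp x / α - mlF α 1 x)) x) (Ioi 0) := fun x hx => by
    have hd := (((Real.hasDerivAt_exp x).div_const α).sub (hasDerivAt_mlF (β := 1) hα hx)).const_mul σ
    have hd2 := (hasDerivAt_mlF (β := 1) hα hx).deriv
    beta_reduce
    rw [hd2]
    refine Eq.trans ?_ (congrArg Neg.neg hd.deriv.symm)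
    ring
  have h' := h.neg_deriv.congr hderiv fun _ _ => rfl
  constructor
  · refine (h.betaTransform hβ hg fun x hx => ?_).congr (fun x hx => ?_) fun _ _ => rfl
    · simpa only [IntegrableOn, mul_left_comm] using (average_exp_sub_mlF hα hβ hx).1.const_mul σ
    · beta_reduce
      rw [← (average_exp_sub_mlF hα hβ hx).2]
      simp_rw [mul_left_comm _ σ]
      rw [integral_const_mul]
      ring
  · refine (h'.betaTransform hβ (measurable_id.mul hg) fun x hx => ?_).congr (fun x hx => ?_)
      fun _ _ => rfl
    · simpa only [IntegrableOn, mul_left_comm] using (average_deriv_mlF_sub_exp hα hβ hx).1.const_mul σ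
    · beta_reduce
      rw [← (average_deriv_mlF_sub_exp hα hβ hx).2]
      simp_rw [mul_left_comm _ σ]
      rw [integral_const_mul]
      ring

/-! ### Densities for `α < 2` -/

theorem hasBernsteinDensity_exp_sub_mlF {α : ℝ} (hα : 0 < α) (hα1 : α ≤ 1) :
    HasBernsteinDensity (fun x => Real.exp x / α - mlF α 1 x) (mlKernel α) :=
  ⟨fun _ ht => mlKernel_nonneg hα.le hα1 ht.le, fun _ hx =>
    ⟨integrableOn_exp_neg_mul_mlKernel hα hx,
      (integral_exp_neg_mul_mlKernel hα (by linarith) hx).symm⟩⟩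

theorem hasBernsteinDensity_mlF_sub_exp {α : ℝ} (hα : 1 ≤ α) (hα2 : α < 2) :
    HasBernsteinDensity (fun x => mlF α 1 x - Real.exp x / α) (fun t => -mlKernel α t) := by
  have hα0 : 0 < α := by linarith
  refine ⟨fun t ht => neg_nonneg.2 (mlKernel_nonpos hα hα2.le ht.le), fun x hx => ?_⟩
  simp_rw [mul_neg]
  refine ⟨(integrableOn_exp_neg_mul_mlKernel hα0 hx).neg, ?_⟩
  rw [integral_neg, integral_exp_neg_mul_mlKernel hα0 hα2 hx]
  ring

theorem hasBernsteinDensity_of_le_one {α β : ℝ} (hα : 0 < α) (hα1 : α ≤ 1) (hβ : 1 < β) :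
    HasBernsteinDensity (fun x => expTerm α β x - mlF α β x) (betaTransform β (mlKernel α)) ∧
      HasBernsteinDensity (fun x => diffDiffOp β (mlF α β) x - expTerm α β x)
        (betaTransform β fun t => t * mlKernel α t) := by
  simpa only [one_mul] using hasBernsteinDensity_of_one (σ := 1) hα hβ (measurable_mlKernel α)
    (by simpa only [one_mul] using hasBernsteinDensity_exp_sub_mlF hα hα1)

theorem hasBernsteinDensity_of_one_le {α β : ℝ} (hα : 1 ≤ α) (hα2 : α < 2) (hβ : 1 < β) :
    HasBernsteinDensity (fun x => mlF α β x - expTerm α β x)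
        (betaTransform β fun t => -mlKernel α t) ∧
      HasBernsteinDensity (fun x => expTerm α β x - diffDiffOp β (mlF α β) x)
        (betaTransform β fun t => -(t * mlKernel α t)) := by
  have h : HasBernsteinDensity (fun x => -1 * (Real.exp x / α - mlF α 1 x))
      (fun t => -mlKernel α t) := by
    simpa only [neg_one_mul, neg_sub] using hasBernsteinDensity_mlF_sub_exp hα hα2
  have hm : Measurable fun t => -mlKernel α t := (measurable_mlKernel α).neg
  simpa only [neg_one_mul, neg_sub, mul_neg] using
    hasBernsteinDensity_of_one (by linarith) hβ hm h

/-! ### The case `α = 2` -/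

theorem mlF_two_one {x : ℝ} (hx : 0 ≤ x) : mlF 2 1 x = Real.cosh x := by
  rw [mlF_eq_tsum hx, ← (Real.hasSum_cosh x).tsum_eq]
  refine tsum_congr fun n => ?_
  have h : (2 : ℝ) * n = ((2 * n : ℕ) : ℝ) := by push_cast; ring
  rw [h, Real.Gamma_nat_eq_factorial, Real.rpow_natCast]

theorem mlF_two_one_sub_exp {x : ℝ} (hx : 0 ≤ x) :
    mlF 2 1 x - Real.exp x / 2 = Real.exp (-x) / 2 := by
  rw [mlF_two_one hx, Real.cosh_eq]
  ring

theorem exp_sub_deriv_mlF_two_one {x : ℝ} (hx : 0 < x) :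
    Real.exp x / 2 - deriv (mlF 2 1) x = Real.exp (-x) / 2 := by
  have he : mlF 2 1 =ᶠ[𝓝 x] Real.cosh := by
    filter_upwards [lt_mem_nhds hx] with y hy using mlF_two_one hy.le
  rw [he.deriv_eq, Real.deriv_cosh, Real.sinh_eq]
  ring

/-- At `α = 2` the poles `z = e ^ (±iπ)` of `z ^ α / (z ^ α - 1)` sit on the cut itself, and the
density degenerates to a point mass. -/
theorem hasBernsteinMeasure_mlF_two_one :
    HasBernsteinMeasure (fun x => mlF 2 1 x - Real.exp x / 2)
      ((1 / 2 : ENNReal) • Measure.dirac (1 : ℝ)) := by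
  refine ⟨by simp, fun x hx => ⟨?_, ?_⟩⟩
  · exact (integrable_dirac (by simp)).smul_measure (by simp)
  · beta_reduce
    rw [mlF_two_one_sub_exp hx.le, integral_smul_measure, integral_dirac]
    simp
    ring

theorem hasBernsteinDensity_average_exp_neg {β : ℝ} (hβ : 1 < β) :
    HasBernsteinDensity
      (fun x => 1 / Real.Gamma (β - 1) *
        ∫ u in Ioo (0 : ℝ) 1, (1 - u) ^ (β - 2) * (Real.exp (-(x * u)) / 2))
      ((Ioo (0 : ℝ) 1).indicator (fun t => (1 - t) ^ (β - 2) / (2 * Real.Gamma (β - 1)))) := by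
  have hΓ := Real.Gamma_pos_of_pos (sub_pos.2 hβ)
  refine ⟨fun t _ => indicator_nonneg (fun u hu => ?_) t, fun x _ => ?_⟩
  · have h1 : 0 ≤ 1 - u := by linarith [hu.2]
    exact div_nonneg (Real.rpow_nonneg h1 _) (by positivity)
  have he : (fun t => Real.exp (-(x * t)) * (Ioo (0 : ℝ) 1).indicator
      (fun t => (1 - t) ^ (β - 2) / (2 * Real.Gamma (β - 1))) t) =
      (Ioo (0 : ℝ) 1).indicator fun t => 1 / Real.Gamma (β - 1) *
        ((1 - t) ^ (β - 2) * (Real.exp (-(x * t)) / 2)) := by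
    ext t
    by_cases ht : t ∈ Ioo (0 : ℝ) 1
    · simp only [indicator_of_mem ht]
      field_simp
    · simp only [indicator_of_notMem ht, mul_zero]
  have hsub : Ioi (0 : ℝ) ∩ Ioo 0 1 = Ioo 0 1 := inter_eq_right.2 fun t ht => ht.1
  have hi : IntegrableOn (fun t : ℝ => (1 - t) ^ (β - 2) * (Real.exp (-(x * t)) / 2))
      (Ioo 0 1) := by
    simpa only [IntegrableOn, mul_div_assoc, neg_mul] using
      (integrableOn_one_sub_rpow_mul_exp hβ (-x)).div_const 2
  rw [he]
  refine ⟨((integrable_indicator_iff measurableSet_Ioo).2 (hi.const_mul _)).integrableOn, ?_⟩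
  rw [setIntegral_indicator measurableSet_Ioo, hsub, integral_const_mul]

theorem hasBernsteinDensity_two {β : ℝ} (hβ : 1 < β) :
    HasBernsteinDensity (fun x => mlF 2 β x - expTerm 2 β x)
        ((Ioo (0 : ℝ) 1).indicator (fun t => (1 - t) ^ (β - 2) / (2 * Real.Gamma (β - 1)))) ∧
      HasBernsteinDensity (fun x => expTerm 2 β x - diffDiffOp β (mlF 2 β) x)
        ((Ioo (0 : ℝ) 1).indicator
          (fun t => (1 - t) ^ (β - 2) / (2 * Real.Gamma (β - 1)))) := by
  constructor
  · refine (hasBernsteinDensity_average_exp_neg hβ).congr (fun x hx => ?_) fun _ _ => rfl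
    beta_reduce
    rw [← neg_sub, ← (average_exp_sub_mlF two_pos hβ hx).2, ← mul_neg, ← integral_neg]
    congr 1
    refine setIntegral_congr_fun measurableSet_Ioo fun u hu => ?_
    rw [← mlF_two_one_sub_exp (mul_pos hx hu.1).le]
    ring
  · refine (hasBernsteinDensity_average_exp_neg hβ).congr (fun x hx => ?_) fun _ _ => rfl
    beta_reduce
    rw [← neg_sub, ← (average_deriv_mlF_sub_exp two_pos hβ hx).2, ← mul_neg, ← integral_neg]
    congr 1
    refine setIntegral_congr_fun measurableSet_Ioo fun u hu => ?_
    rw [← exp_sub_deriv_mlF_two_one (mul_pos hx hu.1)]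
    ring

theorem theoremB :
    -- (a)
    (∀ α : ℝ, 0 < α → α ≤ 1 →
      IsCompletelyMonotone (fun x => Real.exp x / α - mittagLeffler α 1 (x ^ α)) ∧
      HasBernsteinDensity (fun x => Real.exp x / α - mittagLeffler α 1 (x ^ α)) (mlKernel α)) ∧
    -- (b)
    (∀ α β : ℝ, 0 < α → α ≤ 1 → 1 < β →
      (IsCompletelyMonotone (fun x => expTerm α β x - mlF α β x) ∧
        IsCompletelyMonotone (fun x => diffDiffOp β (mlF α β) x - expTerm α β x)) ∧
      HasBernsteinDensity (fun x => expTerm α β x - mlF α β x)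
        (betaTransform β (mlKernel α)) ∧
      HasBernsteinDensity (fun x => diffDiffOp β (mlF α β) x - expTerm α β x)
        (betaTransform β (fun t => t * mlKernel α t))) ∧
    -- (c)
    ((∀ α : ℝ, 1 ≤ α → α ≤ 2 →
      IsCompletelyMonotone (fun x => mittagLeffler α 1 (x ^ α) - Real.exp x / α)) ∧
    (∀ α : ℝ, 1 ≤ α → α < 2 →
      HasBernsteinDensity (fun x => mittagLeffler α 1 (x ^ α) - Real.exp x / α)
        (fun t => -mlKernel α t)) ∧
    HasBernsteinMeasure (fun x => mittagLeffler 2 1 (x ^ (2 : ℝ)) - Real.exp x / 2)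
      ((1 / 2 : ENNReal) • Measure.dirac (1 : ℝ))) ∧
    -- (d)
    ((∀ α β : ℝ, 1 ≤ α → α ≤ 2 → 1 < β →
      IsCompletelyMonotone (fun x => mlF α β x - expTerm α β x) ∧
      IsCompletelyMonotone (fun x => expTerm α β x - diffDiffOp β (mlF α β) x)) ∧
    (∀ α β : ℝ, 1 ≤ α → α < 2 → 1 < β →
      HasBernsteinDensity (fun x => mlF α β x - expTerm α β x)
        (betaTransform β (fun t => -mlKernel α t)) ∧
      HasBernsteinDensity (fun x => expTerm α β x - diffDiffOp β (mlF α β) x)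
        (betaTransform β (fun t => -(t * mlKernel α t)))) ∧
    (∀ β : ℝ, 1 < β →
      HasBernsteinDensity (fun x => mlF 2 β x - expTerm 2 β x)
        ((Ioo (0 : ℝ) 1).indicator
          (fun t => (1 - t) ^ (β - 2) / (2 * Real.Gamma (β - 1)))) ∧
      HasBernsteinDensity (fun x => expTerm 2 β x - diffDiffOp β (mlF 2 β) x)
        ((Ioo (0 : ℝ) 1).indicator
          (fun t => (1 - t) ^ (β - 2) / (2 * Real.Gamma (β - 1)))))) := by
  refine ⟨fun α hα hα1 => ?_, fun α β hα hα1 hβ => ?_, ⟨fun α hα hα2 => ?_, fun α hα hα2 => ?_, ?_⟩,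
    fun α β hα hα2 hβ => ?_, fun α β hα hα2 hβ => ?_, fun β hβ => ?_⟩
  · have h := hasBernsteinDensity_exp_sub_mlF hα hα1
    exact ⟨h.isCompletelyMonotone, h⟩
  · obtain ⟨h1, h2⟩ := hasBernsteinDensity_of_le_one hα hα1 hβ
    exact ⟨⟨h1.isCompletelyMonotone, h2.isCompletelyMonotone⟩, h1, h2⟩
  · rcases hα2.lt_or_eq with h | rfl
    · exact (hasBernsteinDensity_mlF_sub_exp hα h).isCompletelyMonotone
    · exact hasBernsteinMeasure_mlF_two_one.isCompletelyMonotone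
  · exact hasBernsteinDensity_mlF_sub_exp hα hα2
  · exact hasBernsteinMeasure_mlF_two_one
  · rcases hα2.lt_or_eq with h | rfl
    · exact (hasBernsteinDensity_of_one_le hα h hβ).imp (·.isCompletelyMonotone)
        (·.isCompletelyMonotone)
    · exact (hasBernsteinDensity_two hβ).imp (·.isCompletelyMonotone) (·.isCompletelyMonotone)
  · exact hasBernsteinDensity_of_one_le hα hα2 hβ
  · exact hasBernsteinDensity_two hβ
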